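/- Let $R$ be a commutative noetherian local normal domain which is Cohen--Macaulay (CM), with a canonical module $\omega_R$. Here a finitely generated module $X$ over a commutative noetherian ring $A$ is called CM, written $X\in\operatorname{CM}A$, if $\operatorname{depth}_{A_{\mathfrak p}}X_{\mathfrak p}=\dim A_{\mathfrak p}$ for all $\mathfrak p\in\operatorname{Supp}X$. Write $(-)^{*}=\operatorname{Hom}_R(-,R)$, let $\operatorname{refl}R$ be the category of finitely generated reflexive $R$-modules, and put $\omega_R^i=(\omega_R\otimes_R\cdots\otimes_R\omega_R)^{**}$ ($i$ factors) for $i\ge 0$ and $\omega_R^{-i}=(\omega_R^{i})^{*}$ for $i>0$. Assume that $R$ is $\mathbb{Q}$-Gorenstein of index $n$, that is, $n$ is the smallest positive integer such that $\omega_R^n$ is locally free. Let $S$ be a canonical cover of $R$, that is, the $\mathbb{Z}_n$-graded $R$-algebra obtained as follows, where $\mathbb{Z}_n=\mathbb{Z}/n\mathbb{Z}$. Choose an embedding $\omega_R\to R$ with image $I$, and an element $q\ne0$ of the quotient field $K$ of $R$ such that multiplication by $q$ is an isomorphism $(I^n)^{**}\cong R$. Then $S=\bigoplus_{i=0}^{n-1}S_i$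 with $S_i=(I^i)^{**}\subseteq K$, and the product of $x\in S_i$ and $y\in S_j$ is $q^{\lfloor (i+j)/n\rfloor}xy$, an element of the component whose index is $i+j$ modulo $n$. For an $R$-algebra $A$ let $\operatorname{CM}A$ be the category of left $A$-modules which are CM as $R$-modules, and for a $\mathbb{Z}_n$-graded $R$-algebra $A$ let $\operatorname{CM}^{\mathbb{Z}_n}A$ be the category of $\mathbb{Z}_n$-graded left $A$-modules which are CM as $R$-modules, with the $A$-linear maps preserving degrees as morphisms. The product $fg$ in an endomorphism ring means first $f$, then $g$, so that $\operatorname{Hom}_R(N,X)$ is a left $\operatorname{End}_R(N)$-module. For a $\mathbb{Z}_n$-graded $S$-module $N$, the ring $\operatorname{End}_S(N)$ is $\mathbb{Z}_n$-graded, its component of degree $g$ consisting of the $f$ with $f(N_i)\subseteq N_{i+g}$ for all $i$. (1) Let $N\neq0$ be a finitely generated $\mathbb{Z}_n$-graded $S$-module which is reflexive over $S$ and gives a Gorenstein modification (GM) of $S$, that is, $E=\operatorname{End}_S(N)$ satisfies $E\in\operatorname{CM}S$, and the ring $E\otimes_SS_{\mathfrak p}$ has injective dimension $\dim S_{\mathfrak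 p}$ as a left module over itself for all $\mathfrak p\in\operatorname{Supp}_SE$. Then there are equivalences of categories \[ \operatorname{CM}^{\mathbb{Z}_n}\operatorname{End}_S(N)\simeq\operatorname{CM}\operatorname{End}_R(N)\simeq\{X\in\operatorname{refl}R\mid\operatorname{Hom}_R(N,X)\in\operatorname{CM}R\}. \] (2) There is an equivalence of categories (without assuming that $S$ gives a GM of $S$) \[ \operatorname{CM}^{\mathbb{Z}_n}S\simeq\{X\in\operatorname{CM}R\mid(\omega_R^i\otimes_RX)^{**}\in\operatorname{CM}R\text{ for all }i\in\mathbb{Z}\}. \] -/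

import Mathlib

open CategoryTheory
open scoped TensorProduct DirectSum

universe u

namespace CanonicalCovers

noncomputable section

/-! ### Cohen-Macaulay modules, canonical modules, index -/

/-- The depth of a module over a local ring: the supremum of the lengths of the `M`-regular
sequences contained in the maximal ideal. -/
def depth (A : Type u) [CommRing A] [IsLocalRing A] (M : Type u) [AddCommGroup M] [Module A M] :
    ℕ∞ :=
  ⨆ rs : {rs : List A //
    (∀ r ∈ rs, r ∈ IsLocalRing.maximalIdeal A) ∧ RingTheory.Sequence.IsRegular M rs},
    (rs.1.length : ℕ∞)

/-- `M ∈ CM A`: a finitely generated module with `depth M_p = dim A_p` for every prime `p` in the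
support of `M` (so the zero module is allowed). -/
structure IsCM (A : Type u) [CommRing A] (M : Type u) [AddCommGroup M] [Module A M] : Prop where
  finite : Module.Finite A M
  depth_eq : ∀ p : PrimeSpectrum A, p ∈ Module.support A M →
    (depth (Localization.AtPrime p.asIdeal) (LocalizedModule p.asIdeal.primeCompl M) :
      WithBot ℕ∞) = ringKrullDim (Localization.AtPrime p.asIdeal)

/-- A canonical module of a (Cohen-Macaulay) local ring `R` of dimension `d` with residue
field `k`: a maximal Cohen-Macaulay module of finite injective dimension and of type `1`, that is,
`Ext^d_R(k, ω)` has length one. -/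
structure IsCanonicalModule (R : Type u) [CommRing R] [IsLocalRing R]
    (ω : Type u) [AddCommGroup ω] [Module R ω] : Prop where
  isCM : IsCM R ω
  finite_injectiveDimension : injectiveDimension (ModuleCat.of R ω) < ⊤
  type_eq_one : ∀ d : ℕ, ringKrullDim R = d →
    Module.length R (Abelian.Ext.{u} (ModuleCat.of R (IsLocalRing.ResidueField R))
      (ModuleCat.of R ω) d) = 1

/-- The reflexive hull (double dual) `M^{**}`. -/
abbrev BiDual (R : Type u) [CommRing R] (M : Type u) [AddCommGroup M] [Module R M] : Type u :=
  Module.Dual R (Module.Dual R M)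

/-- The reflexive powers `ω^i`: `(ω ⊗ ⋯ ⊗ ω)^{**}` (`i` factors) for `i ≥ 0`, and
`ω^{-i} = (ω^i)^*` for `i > 0`. -/
def reflPow (R : Type u) [CommRing R] (ω : Type u) [AddCommGroup ω] [Module R ω] :
    ℤ → ModuleCat.{u} R
  | Int.ofNat i => ModuleCat.of R (BiDual R (⨂[R]^i ω))
  | Int.negSucc i => ModuleCat.of R (Module.Dual R (BiDual R (⨂[R]^(i + 1) ω)))

/-- A finitely generated module is locally free if all its stalks are free. -/
def IsLocallyFree (R : Type u) [CommRing R] (M : Type u) [AddCommGroup M] [Module R M] : Prop :=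
  ∀ p : PrimeSpectrum R, Module.Free (Localization.AtPrime p.asIdeal)
    (LocalizedModule p.asIdeal.primeCompl M)

/-- `R` is `ℚ`-Gorenstein of index `n`: `n` is the least positive integer such that `ω^n` is
locally free. -/
def IsQGorensteinOfIndex (R : Type u) [CommRing R] (ω : Type u) [AddCommGroup ω] [Module R ω]
    (n : ℕ) : Prop :=
  IsLeast {m : ℕ | 0 < m ∧ IsLocallyFree R (reflPow R ω m)} n

/-! ### Canonical covers -/

section Hull

variable {R : Type u} [CommRing R] {K : Type u} [CommRing K] [Algebra R K]

/-- The divisorial hull `(R : (R : J))` of an `R`-submodule `J` of the quotient field of `R`; for a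
nonzero fractional ideal `J` of a domain, this is `J^{**}` inside the quotient field. -/
def divHull (J : Submodule R K) : Submodule R K := 1 / (1 / J)

lemma mem_divHull {J : Submodule R K} {x : K} :
    x ∈ divHull J ↔ ∀ w : K, (∀ a ∈ J, w * a ∈ (1 : Submodule R K)) →
      x * w ∈ (1 : Submodule R K) := by
  simp only [divHull, Submodule.mem_div_iff_forall_mul_mem]

lemma le_divHull (J : Submodule R K) : J ≤ divHull J := by
  intro x hx
  rw [mem_divHull]
  intro w hw
  rw [mul_comm]
  exact hw x hx

lemma mul_mem_divHull_mul {I J : Submodule R K} {x y : K} (hx : x ∈ divHull I)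
    (hy : y ∈ divHull J) : x * y ∈ divHull (I * J) := by
  rw [mem_divHull] at *
  intro w hw
  rw [mul_assoc]
  refine hx _ fun a ha => ?_
  have h : y * (w * a) ∈ (1 : Submodule R K) := by
    refine hy _ fun b hb => ?_
    rw [mul_assoc]
    exact hw _ (Submodule.mul_mem_mul ha hb)
  rwa [← mul_assoc] at h

lemma divHull_one : divHull (1 : Submodule R K) = 1 := by
  refine le_antisymm (fun x hx => ?_) (le_divHull 1)
  rw [mem_divHull] at hx
  simpa using hx 1 fun a ha => by simpa using ha

end Hull

/-- The choices made in the construction of a canonical cover of index `n`: an embedding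
`ω → R`, with image an ideal `I`, and an element `q ≠ 0` of the quotient field such that
multiplication by `q` maps `(I^n)^{**}` isomorphically onto `R`. -/
structure CoverDatum (R : Type u) [CommRing R] [IsDomain R] (ω : Type u) [AddCommGroup ω]
    [Module R ω] (n : ℕ) where
  /-- the embedding of `ω` into `R` -/
  emb : ω →ₗ[R] R
  emb_injective : Function.Injective emb
  /-- the element `q` -/
  q : (FractionRing R)ˣ
  map_q : (divHull (Submodule.map (Algebra.linearMap R (FractionRing R))
    (LinearMap.range emb) ^ n)).map (LinearMap.mulLeft R (q : FractionRing R)) = 1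

namespace CoverDatum

variable {R : Type u} [CommRing R] [IsDomain R] {ω : Type u} [AddCommGroup ω] [Module R ω] {n : ℕ}

/-- The image `I` of `ω`, as a fractional ideal. -/
def ideal (D : CoverDatum R ω n) : Submodule R (FractionRing R) :=
  Submodule.map (Algebra.linearMap R (FractionRing R)) (LinearMap.range D.emb)

/-- The graded piece `S_i = ω^i = (I^i)^{**}` for `i = 0, …, n - 1`. -/
def piece (D : CoverDatum R ω n) (i : ZMod n) : Submodule R (FractionRing R) :=
  divHull (D.ideal ^ i.val)

lemma q_mul_mem (D : CoverDatum R ω n) {k : ℕ} {x : FractionRing R}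
    (hx : x ∈ divHull (D.ideal ^ (n + k))) : (D.q : FractionRing R) * x ∈ divHull (D.ideal ^ k) := by
  rw [mem_divHull] at *
  intro w hw
  have h := hx (D.q * w) fun a ha => ?_
  · rwa [mul_comm (D.q : FractionRing R) x, mul_assoc]
  · rw [pow_add] at ha
    induction ha using Submodule.mul_induction_on' with
    | mem_mul_mem a ha b hb =>
      have h1 : (D.q : FractionRing R) * a ∈ (1 : Submodule R (FractionRing R)) := by
        rw [← D.map_q]
        exact ⟨a, le_divHull _ ha, rfl⟩
      have h2 := Submodule.mul_mem_mul h1 (hw b hb)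
      rw [one_mul] at h2
      convert h2 using 1
      ring
    | add a _ b _ ha hb => rw [mul_add]; exact add_mem ha hb

/-- The cocycle `q(i, j) = q ^ ⌊(i + j) / n⌋`, for `i, j ∈ {0, …, n - 1}`. -/
def coc (D : CoverDatum R ω n) (i j : ZMod n) : FractionRing R :=
  (D.q : FractionRing R) ^ ((i.val + j.val) / n)

lemma coc_comm (D : CoverDatum R ω n) (i j : ZMod n) : D.coc i j = D.coc j i := by
  simp [coc, add_comm]

lemma one_mem_piece (D : CoverDatum R ω n) : (1 : FractionRing R) ∈ D.piece 0 := by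
  simp [piece, divHull_one]

lemma gradedMonoid_ext (D : CoverDatum R ω n) {a b : GradedMonoid fun i => D.piece i}
    (h1 : a.1 = b.1) (h2 : (a.2 : FractionRing R) = b.2) : a = b := by
  obtain ⟨i, a⟩ := a
  obtain ⟨j, b⟩ := b
  obtain rfl : i = j := h1
  congr
  exact Subtype.ext h2

variable [NeZero n]

lemma coc_mul_mem (D : CoverDatum R ω n) {i j : ZMod n} {x y : FractionRing R}
    (hx : x ∈ D.piece i) (hy : y ∈ D.piece j) : D.coc i j * (x * y) ∈ D.piece (i + j) := by
  have hxy := mul_mem_divHull_mul hx hy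
  rw [← pow_add] at hxy
  have hn : 0 < n := NeZero.pos n
  have hi := ZMod.val_lt i
  have hj := ZMod.val_lt j
  unfold coc piece
  by_cases h : i.val + j.val < n
  · rw [Nat.div_eq_of_lt h, ZMod.val_add_of_lt h, pow_zero, one_mul]
    exact hxy
  · push Not at h
    have h1 : (i.val + j.val) / n = 1 := by
      rw [Nat.div_eq_iff hn]; omega
    have h2 := ZMod.val_add_val_of_le h
    rw [h1, pow_one]
    apply D.q_mul_mem
    rwa [add_comm n, ← h2]

lemma coc_zero_left (D : CoverDatum R ω n) (j : ZMod n) : D.coc 0 j = 1 := by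
  simp [coc, Nat.div_eq_of_lt (ZMod.val_lt j)]

lemma coc_assoc (D : CoverDatum R ω n) (i j k : ZMod n) :
    D.coc (i + j) k * D.coc i j = D.coc i (j + k) * D.coc j k := by
  have hn : 0 < n := NeZero.pos n
  unfold coc
  rw [← pow_add, ← pow_add]
  congr 1
  rw [ZMod.val_add, ZMod.val_add]
  have key : ∀ a b : ℕ, (a % n + b) / n + a / n = (a + b) / n := by
    intro a b
    conv_rhs => rw [← Nat.mod_add_div a n, add_right_comm, Nat.add_mul_div_left _ _ hn]
  rw [key, add_comm i.val ((j.val + k.val) % n), key]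
  congr 1
  ring

/-- The product of `x ∈ S_i` and `y ∈ S_j` is `q(i, j) x y ∈ S_{i + j}`. -/
instance gMul (D : CoverDatum R ω n) : GradedMonoid.GMul fun i => D.piece i where
  mul {i j} x y := ⟨D.coc i j * (x * y), D.coc_mul_mem x.2 y.2⟩

instance gOne (D : CoverDatum R ω n) : GradedMonoid.GOne fun i => D.piece i where
  one := ⟨1, D.one_mem_piece⟩

lemma coe_mul (D : CoverDatum R ω n) {i j : ZMod n} (x : D.piece i) (y : D.piece j) :
    ((GradedMonoid.GMul.mul (A := fun i => D.piece i) x y : D.piece (i + j)) : FractionRing R) =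
      D.coc i j * (x * y) := rfl

instance gCommRing (D : CoverDatum R ω n) : DirectSum.GCommRing fun i => D.piece i where
  mul_comm a b := D.gradedMonoid_ext (add_comm _ _) (by
    change D.coc a.1 b.1 * (a.2 * b.2 : FractionRing R) = D.coc b.1 a.1 * (b.2 * a.2)
    rw [D.coc_comm, mul_comm (a.2 : FractionRing R)])
  one_mul a := D.gradedMonoid_ext (zero_add _) (by
    change D.coc 0 a.1 * (1 * a.2 : FractionRing R) = a.2
    rw [coc_zero_left, one_mul, one_mul])
  mul_one a := D.gradedMonoid_ext (add_zero _) (by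
    change D.coc a.1 0 * (a.2 * 1 : FractionRing R) = a.2
    rw [D.coc_comm, coc_zero_left, one_mul, mul_one])
  mul_assoc a b c := D.gradedMonoid_ext (add_assoc _ _ _) (by
    change D.coc (a.1 + b.1) c.1 * (D.coc a.1 b.1 * (a.2 * b.2) * c.2 : FractionRing R) =
      D.coc a.1 (b.1 + c.1) * (a.2 * (D.coc b.1 c.1 * (b.2 * c.2)))
    linear_combination ((a.2 : FractionRing R) * b.2 * c.2) * D.coc_assoc a.1 b.1 c.1)
  mul_zero a := Subtype.ext (by simp [coe_mul])
  zero_mul b := Subtype.ext (by simp [coe_mul])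
  mul_add a b c := Subtype.ext (by simp [coe_mul, mul_add])
  add_mul a b c := Subtype.ext (by simp [coe_mul, mul_add, add_mul])
  natCast m := m • GradedMonoid.GOne.one (A := fun i => D.piece i)
  natCast_zero := zero_smul _ _
  natCast_succ m := by rw [add_smul, one_smul]
  intCast m := m • GradedMonoid.GOne.one (A := fun i => D.piece i)
  intCast_ofNat m := natCast_zsmul _ _
  intCast_negSucc_ofNat m := by rw [← natCast_zsmul, ← neg_zsmul]; congr 1

/-- The identification `S_0 = R` makes the canonical cover an `R`-algebra. -/
instance gAlgebra (D : CoverDatum R ω n) : DirectSum.GAlgebra R fun i => D.piece i where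
  toFun := { toFun := fun r => r • GradedMonoid.GOne.one (A := fun i => D.piece i)
             map_zero' := zero_smul _ _
             map_add' := fun r s => add_smul r s _ }
  map_one := one_smul _ _
  map_mul r s := D.gradedMonoid_ext (add_zero (0 : ZMod n)).symm (by
    change (r * s) • (1 : FractionRing R) = D.coc 0 0 * ((r • (1 : FractionRing R)) * (s • 1))
    rw [coc_zero_left]
    simp [Algebra.smul_def])
  commutes r x := D.gradedMonoid_ext (add_comm _ _) (by
    change D.coc 0 x.1 * ((r • (1 : FractionRing R)) * x.2) = D.coc x.1 0 * (x.2 * r • 1)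
    rw [D.coc_comm, mul_comm (x.2 : FractionRing R)])
  smul_def r x := D.gradedMonoid_ext (zero_add _).symm (by
    change r • (x.2 : FractionRing R) = D.coc 0 x.1 * ((r • (1 : FractionRing R)) * x.2)
    rw [coc_zero_left]
    simp [Algebra.smul_def])

/-- The canonical cover `S = ⨁_{i ∈ ℤ/n} ω^i`. -/
def Cover (D : CoverDatum R ω n) : Type u := ⨁ i : ZMod n, D.piece i

instance (D : CoverDatum R ω n) : CommRing D.Cover :=
  inferInstanceAs (CommRing (⨁ i : ZMod n, D.piece i))

instance (D : CoverDatum R ω n) : Algebra R D.Cover :=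
  inferInstanceAs (Algebra R (⨁ i : ZMod n, D.piece i))

/-- The inclusion `S_i → S` of a graded piece. -/
def incl (D : CoverDatum R ω n) (i : ZMod n) : D.piece i →ₗ[R] D.Cover :=
  DirectSum.lof R (ZMod n) (fun i => D.piece i) i

/-- The grading of the canonical cover. -/
def grading (D : CoverDatum R ω n) (i : ZMod n) : AddSubgroup D.Cover :=
  (D.incl i).toAddMonoidHom.range

lemma incl_mul_incl (D : CoverDatum R ω n) {i j : ZMod n} (x : D.piece i) (y : D.piece j) :
    D.incl i x * D.incl j y = D.incl (i + j) ⟨D.coc i j * (x * y), D.coc_mul_mem x.2 y.2⟩ :=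
  DirectSum.of_mul_of _ _

end CoverDatum

/-! ### Graded modules -/

section Graded

variable {ι : Type} [AddCommMonoid ι] [DecidableEq ι]

/-- `M = ⨁ M_i` with `A_i M_j ⊆ M_{i + j}`. -/
structure IsGradedModule {A : Type u} [Ring A] (𝒜 : ι → AddSubgroup A)
    {M : Type u} [AddCommGroup M] [Module A M] (ℳ : ι → AddSubgroup M) : Prop where
  isInternal : DirectSum.IsInternal ℳ
  smul_mem : ∀ (i j : ι) (a : A) (x : M), a ∈ 𝒜 i → x ∈ ℳ j → a • x ∈ ℳ (i + j)

/-- The objects of `Mod^ι A`: graded modules over a graded ring. -/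
structure GradedMod {A : Type u} [Ring A] (𝒜 : ι → AddSubgroup A) where
  /-- the underlying module -/
  carrier : ModuleCat.{u} A
  /-- the homogeneous components -/
  deg : ι → AddSubgroup carrier
  isGraded : IsGradedModule 𝒜 deg

namespace GradedMod

variable {A : Type u} [Ring A] {𝒜 : ι → AddSubgroup A}

/-- Morphisms of graded modules: linear maps preserving degrees. -/
@[ext]
structure Hom (X Y : GradedMod 𝒜) where
  /-- the underlying linear map -/
  toHom : X.carrier ⟶ Y.carrier
  map_mem : ∀ (i : ι) (x : X.carrier), x ∈ X.deg i → toHom x ∈ Y.deg i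

instance : Category (GradedMod 𝒜) where
  Hom := Hom
  id X := ⟨𝟙 X.carrier, fun _ _ h => h⟩
  comp f g := ⟨f.toHom ≫ g.toHom, fun i x h => g.map_mem i _ (f.map_mem i x h)⟩

end GradedMod

end Graded

/-! ### Endomorphism rings and categories of Cohen-Macaulay modules -/

/-- The endomorphism ring in which the product `f g` means "first `f`, then `g`", so that
`Hom_A(N, X)` is a left module over `End_A(N)`. -/
abbrev EndRing (A : Type u) [CommRing A] (N : Type u) [AddCommGroup N] [Module A N] : Type u :=
  (Module.End A N)ᵐᵒᵖ

/-- The grading of `End_A(N)`, for a graded module `N`: the component of degree `g` consists of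
the endomorphisms which map `N_i` to `N_{i + g}` for all `i`. -/
def endGrading {ι : Type} [AddCommMonoid ι] (A : Type u) [CommRing A] {N : Type u}
    [AddCommGroup N] [Module A N] (𝒩 : ι → AddSubgroup N) (g : ι) : AddSubgroup (EndRing A N) where
  carrier := {f | ∀ (i : ι) (x : N), x ∈ 𝒩 i → f.unop x ∈ 𝒩 (i + g)}
  zero_mem' := fun _ _ _ => zero_mem _
  add_mem' := fun hf hg i x hx => add_mem (hf i x hx) (hg i x hx)
  neg_mem' := fun hf i x hx => neg_mem (hf i x hx)

/-- `N` gives a Gorenstein modification of `A`: for `E = End_A(N)` one has `E ∈ CM A`, and the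
injective dimension of the ring `E ⊗_A A_p` as a module over itself equals `dim A_p`, for all primes
`p` in the support of `E`. -/
structure GivesGM (A : Type u) [CommRing A] (N : Type u) [AddCommGroup N] [Module A N] : Prop where
  finite : Module.Finite A N
  isReflexive : Module.IsReflexive A N
  isCM : IsCM A (EndRing A N)
  injectiveDimension_eq : ∀ p : PrimeSpectrum A, p ∈ Module.support A (EndRing A N) →
    injectiveDimension (ModuleCat.of (EndRing A N ⊗[A] Localization.AtPrime p.asIdeal)
      (EndRing A N ⊗[A] Localization.AtPrime p.asIdeal)) =
        ringKrullDim (Localization.AtPrime p.asIdeal)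

variable (R : Type u) [CommRing R]

/-- For an `R`-algebra `A`, the property of `A`-modules of being Cohen-Macaulay as an
`R`-module. -/
def isCMAlg (A : Type u) [Ring A] [Algebra R A] : ObjectProperty (ModuleCat.{u} A) :=
  fun X => IsCM R ((ModuleCat.restrictScalars (algebraMap R A)).obj X)

/-- The category `CM A` of an `R`-algebra `A`. -/
abbrev CMCat (A : Type u) [Ring A] [Algebra R A] : Type (u + 1) := (isCMAlg R A).FullSubcategory

/-- The category `CM^ι A` of a graded `R`-algebra `A`: graded `A`-modules, Cohen-Macaulay as
`R`-modules. -/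
abbrev GradedCMCat {ι : Type} [AddCommMonoid ι] [DecidableEq ι] {A : Type u} [Ring A] [Algebra R A]
    (𝒜 : ι → AddSubgroup A) : Type (u + 1) :=
  ObjectProperty.FullSubcategory (fun X : GradedMod 𝒜 => isCMAlg R A X.carrier)

/-- The full subcategory `{X ∈ refl R ∣ Hom_R(N, X) ∈ CM R}` of the category of `R`-modules. -/
abbrev ZCat (N : Type u) [AddCommGroup N] [Module R N] : Type (u + 1) :=
  ObjectProperty.FullSubcategory (fun X : ModuleCat.{u} R =>
    Module.Finite R X ∧ Module.IsReflexive R X ∧ IsCM R (N →ₗ[R] X))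

/-- The full subcategory `{X ∈ CM R ∣ (ω^i ⊗ X)^{**} ∈ CM R for all i ∈ ℤ}` of the category of
`R`-modules. -/
abbrev OmegaStableCMCat (ω : Type u) [AddCommGroup ω] [Module R ω] : Type (u + 1) :=
  ObjectProperty.FullSubcategory (fun X : ModuleCat.{u} R =>
    IsCM R X ∧ ∀ i : ℤ, IsCM R (BiDual R (reflPow R ω i ⊗[R] X)))

end

end CanonicalCovers

set_option linter.unusedSectionVars false

/-! Reflexive modules over a normal noetherian domain are determined in codimension one, and in
codimension one S is strongly graded with S_0 = R. Localization at height-one primes is replaced by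
Glaz-Vasconcelos (GV) ideals. A w-module is a torsion-free module in which divisibility by a nonzero
a may be tested after multiplication by the elements of a GV ideal. For finitely generated R-modules
this is the same as reflexivity (`IsWModule.of_isReflexive`, `IsWModule.isReflexive`), and
Cohen-Macaulay modules are w-modules because GV primes have height at least two (`IsCM.isWModule`).
One pattern recurs: the wanted element or map is written down after multiplication by some a ≠ 0,
and the division by a is justified on a GV ideal, such as a trace ideal (`isGV_traceIdeal`) or the
scalars factoring through a finite free module (`isGV_freeScalars`).

Grading. The ideal S_i S_{-i} contains the trace ideal of S_i, hence is GV
(`CoverDatum.isGVStronglyGraded`). So for a graded S-module N that is a w-module over R, each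
R-linear map N_i → N_j extends uniquely to an S-linear endomorphism of N of degree j - i. This says
that End_R(N), with the projections as idempotents, is a smash product of the graded ring End_S(N)
(`IsGVStronglyGraded.isSmashProduct_end`). Modules over a smash product are the same as graded
modules (`IsSmashProduct.nonempty_equivalence`), with the same underlying R-module, so the CM
condition is untouched.

Reflexive Morita theory. Hom_R(N, -) is fully faithful on reflexive modules, and a CM module Y over
End_R(N) is Hom_R(N, X) for X the equivariant maps from Hom_R(N, R) to Y
(`nonempty_equivalence_zCat`). Together these give (1).

For (2), take N = S: End_R(S) is a smash product of S itself
(`IsGVStronglyGraded.isSmashProduct_self`). Moreover Hom_R(S, X) is the product of the Hom_R(S_j,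
X), and these are, up to isomorphism, the modules (ω^i ⊗ X)^{**}, which are periodic in i through
multiplication by q (`nonempty_biDual_tensor_equiv`, `CoverDatum.forall_isCM_reflPow_iff`). -/

namespace CanonicalCovers

/-! ### Glaz-Vasconcelos ideals and `w`-modules -/

section GV

variable {R : Type*} [CommRing R]

/-- `J` is a Glaz-Vasconcelos ideal: it is nonzero and `(R : J) = R`. -/
def IsGV (J : Ideal R) : Prop :=
  J ≠ ⊥ ∧ ∀ a b : R, a ≠ 0 → (∀ r ∈ J, a ∣ r * b) → a ∣ b

lemma IsGV.mono {I J : Ideal R} (hI : IsGV I) (h : I ≤ J) : IsGV J :=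
  ⟨fun hJ => hI.1 (le_bot_iff.1 (hJ ▸ h)), fun a b ha H => hI.2 a b ha fun r hr => H r (h hr)⟩

lemma isGV_top [Nontrivial R] : IsGV (⊤ : Ideal R) :=
  ⟨top_ne_bot, fun a b _ h => by simpa using h 1 trivial⟩

lemma IsGV.exists_ne_zero {J : Ideal R} (hJ : IsGV J) : ∃ r ∈ J, r ≠ 0 :=
  Submodule.exists_mem_ne_zero_of_ne_bot hJ.1

/-- This is (R : IJ) = ((R : I) : J): divide out J first, then I. -/
lemma IsGV.mul [IsDomain R] {I J : Ideal R} (hI : IsGV I) (hJ : IsGV J) : IsGV (I * J) := by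
  refine ⟨fun h => ?_, fun a b ha H => hI.2 a b ha fun r hr => hJ.2 a _ ha fun s hs => ?_⟩
  · exact (mul_eq_zero.1 h).elim hI.1 hJ.1
  · have := H (r * s) (Ideal.mul_mem_mul hr hs)
    rwa [mul_left_comm, ← mul_assoc]

/-- A torsion-free module `M` such that `J y ⊆ a M` implies `y ∈ a M` for `J` a Glaz-Vasconcelos
ideal. -/
structure IsWModule (R : Type*) [CommRing R] (M : Type*) [AddCommGroup M] [Module R M] : Prop where
  isTorsionFree : Module.IsTorsionFree R M
  exists_eq_smul : ∀ {J : Ideal R}, IsGV J → ∀ {a : R}, a ≠ 0 → ∀ {y : M},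
    (∀ r ∈ J, ∃ z : M, r • y = a • z) → ∃ z : M, y = a • z

variable [IsDomain R] {M N P : Type*} [AddCommGroup M] [Module R M] [AddCommGroup N] [Module R N]
  [AddCommGroup P] [Module R P]

variable (R) in
lemma isWModule_self : IsWModule R R where
  isTorsionFree := inferInstance
  exists_eq_smul hJ a ha y h := hJ.2 a y ha fun r hr => h r hr

lemma IsWModule.of_retract (hN : IsWModule R N) (i : M →ₗ[R] N) (p : N →ₗ[R] M)
    (h : ∀ x, p (i x) = x) : IsWModule R M where
  isTorsionFree := by
    have := hN.isTorsionFree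
    exact Function.Injective.moduleIsTorsionFree i (Function.LeftInverse.injective h) (by simp)
  exists_eq_smul hJ a ha y H := by
    obtain ⟨z, hz⟩ := hN.exists_eq_smul hJ ha (y := i y) fun r hr => by
      obtain ⟨z, hz⟩ := H r hr
      exact ⟨i z, by rw [← map_smul, hz, map_smul]⟩
    exact ⟨p z, by rw [← map_smul, ← hz, h]⟩

lemma IsWModule.of_linearEquiv (hN : IsWModule R N) (e : M ≃ₗ[R] N) : IsWModule R M :=
  hN.of_retract e.toLinearMap e.symm.toLinearMap (by simp)

section Linear

variable {S : Type*} [Semiring S] {M' : Type*} [AddCommGroup M'] [Module S M'] [Module S N]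
  [SMulCommClass S R N]

/-- Quotients by a are unique in a torsion-free module, so a pointwise choice of them is
automatically linear. -/
lemma exists_linearMap_eq_smul [Module.IsTorsionFree R N] {a : R} (ha : a ≠ 0) (y : M' →ₗ[S] N)
    (h : ∀ x, ∃ z, y x = a • z) : ∃ g : M' →ₗ[S] N, y = a • g := by
  choose g hg using h
  refine ⟨{ toFun := g, map_add' := fun x x' => ?_, map_smul' := fun r x => ?_ }, ?_⟩
  · apply smul_right_injective N ha
    simp only [smul_add, ← hg, map_add]
  · apply smul_right_injective N ha
    simp only [RingHom.id_apply, ← smul_comm r a, ← hg, map_smul]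
  · ext x
    exact hg x

-- Divisibility of a map is tested pointwise, so nothing is needed of the source. Scalars other than
-- R are allowed in order to treat duals over the cover as R-modules.
variable (S M') in
lemma IsWModule.linearMap (hN : IsWModule R N) : IsWModule R (M' →ₗ[S] N) where
  isTorsionFree := by
    have := hN.isTorsionFree
    exact Function.Injective.moduleIsTorsionFree (fun f : M' →ₗ[S] N => (f : M' → N))
      DFunLike.coe_injective fun _ _ => rfl
  exists_eq_smul hJ a ha y H := by
    have := hN.isTorsionFree
    refine exists_linearMap_eq_smul ha y fun x => hN.exists_eq_smul hJ ha fun r hr => ?_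
    obtain ⟨z, hz⟩ := H r hr
    exact ⟨z x, by rw [← LinearMap.smul_apply, hz, LinearMap.smul_apply]⟩

end Linear

lemma IsWModule.pi {ι : Type*} {M : ι → Type*} [∀ i, AddCommGroup (M i)] [∀ i, Module R (M i)]
    (h : ∀ i, IsWModule R (M i)) : IsWModule R (∀ i, M i) where
  isTorsionFree := by
    have := fun i => (h i).isTorsionFree
    infer_instance
  exists_eq_smul hJ a ha y H := by
    have key : ∀ i, ∃ z : M i, y i = a • z := fun i =>
      (h i).exists_eq_smul hJ ha fun r hr => by
        obtain ⟨z, hz⟩ := H r hr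
        exact ⟨z i, congrFun hz i⟩
    choose z hz using key
    exact ⟨z, funext hz⟩

/-- A reflexive module is a dual, hence a module of maps into the w-module R. -/
lemma IsWModule.of_isReflexive [Module.IsReflexive R M] : IsWModule R M :=
  ((isWModule_self R).linearMap R _).of_linearEquiv (Module.evalEquiv R M)

/-- A linear map whose kernel and cokernel are annihilated by a Glaz-Vasconcelos ideal becomes
an isomorphism under `Hom(-, N)` for every `w`-module `N`. -/
lemma IsWModule.bijective_lcomp (hP : IsWModule R P) (f : M →ₗ[R] N) {J : Ideal R} (hJ : IsGV J)
    (hker : ∀ x, f x = 0 → ∀ r ∈ J, r • x = 0) (hcoker : ∀ y, ∀ r ∈ J, ∃ x, f x = r • y) :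
    Function.Bijective (LinearMap.lcomp R P f) := by
  have := hP.isTorsionFree
  obtain ⟨a, haJ, ha⟩ := hJ.exists_ne_zero
  constructor
  · rw [injective_iff_map_eq_zero]
    intro g hg
    ext y
    obtain ⟨x, hx⟩ := hcoker y a haJ
    have h1 : g (f x) = 0 := LinearMap.congr_fun hg x
    rw [hx, map_smul] at h1
    simpa [ha] using h1
  · intro g
    have hg : ∀ x, f x = 0 → g x = 0 := fun x hx => by
      have := congrArg g (hker x hx a haJ)
      rw [map_smul, map_zero] at this
      simpa [ha] using this
    have hg' : ∀ x x', f x = f x' → g x = g x' := fun x x' hx => by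
      rw [← sub_eq_zero, ← map_sub]
      exact hg _ (by rw [map_sub, hx, sub_self])
    -- Since `s y` is a preimage of a • y, `g (s y)` is a times the value that the extension of g
    -- must take at y.
    choose s hs using fun y => hcoker y a haJ
    let t : N →ₗ[R] P :=
      { toFun := fun y => g (s y)
        map_add' := fun y y' => by
          rw [← map_add]
          exact hg' _ _ (by rw [map_add, hs, hs, hs, smul_add])
        map_smul' := fun r y => by
          rw [RingHom.id_apply, ← map_smul]
          exact hg' _ _ (by rw [map_smul, hs, hs, smul_comm]) }
    have ht : ∀ y x, f x = a • y → t y = g x := fun y x hx => hg' _ _ (by rw [hs, hx])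
    obtain ⟨u, hu⟩ := exists_linearMap_eq_smul ha t fun y =>
      hP.exists_eq_smul hJ ha fun r hr => by
        obtain ⟨x, hx⟩ := hcoker y r hr
        refine ⟨g x, ?_⟩
        rw [← map_smul, ← map_smul]
        exact ht _ _ (by rw [map_smul, hx])
    refine ⟨u, ?_⟩
    ext x
    apply smul_right_injective P ha
    change a • u (f x) = a • g x
    rw [← LinearMap.smul_apply, ← hu, ← map_smul]
    exact ht _ _ (by rw [map_smul])

/-! ### The trace ideal -/

variable (R M) in
/-- The trace ideal of a module. -/
def traceIdeal : Ideal R :=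
  Ideal.span {r | ∃ (f : M →ₗ[R] R) (m : M), f m = r}

lemma mem_traceIdeal (f : M →ₗ[R] R) (m : M) : f m ∈ traceIdeal R M :=
  Ideal.subset_span ⟨f, m, rfl⟩

/-- If x = b/a multiplies the trace ideal into R, then x carries the functionals M → R, viewed
inside Hom(M, K), to functionals again. They form a nonzero finitely generated module, so x is
integral over R by the determinant trick, and lies in R by normality. -/
lemma isGV_traceIdeal [IsNoetherianRing R] [IsIntegrallyClosed R] [Module.Finite R M]
    {f : M →ₗ[R] R} (hf : f ≠ 0) : IsGV (traceIdeal R M) := by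
  constructor
  · intro h
    apply hf
    ext m
    have := mem_traceIdeal f m
    rw [h] at this
    simpa using this
  · intro a b ha H
    let K := FractionRing R
    let ψ : (M →ₗ[R] R) →ₗ[R] (M →ₗ[R] K) := (Algebra.linearMap R K).compRight R
    have hψ : ∀ g m, ψ g m = algebraMap R K (g m) := fun g m => rfl
    have haK : algebraMap R K a ≠ 0 := by simpa using ha
    have key : IsIntegral R (algebraMap R K b / algebraMap R K a) := by
      refine isIntegral_of_smul_mem_submodule (M := M →ₗ[R] K) (LinearMap.range ψ) ?_ ?_ _ ?_
      · intro h
        have : ψ f ∈ LinearMap.range ψ := ⟨f, rfl⟩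
        rw [h, Submodule.mem_bot] at this
        apply hf
        ext m
        have := LinearMap.congr_fun this m
        rw [hψ] at this
        simpa using this
      · exact (LinearMap.range_eq_map ψ) ▸ Module.Finite.fg_top.map ψ
      · rintro _ ⟨g, rfl⟩
        obtain ⟨g', hg'⟩ := exists_linearMap_eq_smul ha (b • g) fun m => by
          obtain ⟨c, hc⟩ := H _ (mem_traceIdeal g m)
          exact ⟨c, by simp [← hc, mul_comm]⟩
        refine ⟨g', ?_⟩
        ext m
        have := LinearMap.congr_fun hg' m
        simp only [LinearMap.smul_apply, smul_eq_mul] at this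
        rw [LinearMap.smul_apply, hψ, hψ, smul_eq_mul, div_mul_eq_mul_div, eq_div_iff haK,
          ← map_mul, ← map_mul, this, mul_comm]
    obtain ⟨c, hc⟩ := IsIntegrallyClosed.isIntegral_iff.1 key
    refine ⟨c, ?_⟩
    apply IsFractionRing.injective R K
    rw [map_mul, hc, mul_div_cancel₀ _ haK]

/-! ### The ideal of scalars which factor through a finite free module -/

variable (R M) in
/-- The ideal of all `r` such that multiplication by `r` on `M` factors through a finite free
module. -/
def freeScalars : Ideal R :=
  (LinearMap.range (dualTensorHom R M M)).comap (LinearMap.toSpanSingleton R _ LinearMap.id)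

lemma mem_freeScalars {r : R} :
    r ∈ freeScalars R M ↔ r • LinearMap.id ∈ LinearMap.range (dualTensorHom R M M) := Iff.rfl

lemma smulRight_mem_range (f : M →ₗ[R] R) (n : N) :
    f.smulRight n ∈ LinearMap.range (dualTensorHom R M N) :=
  ⟨f ⊗ₜ n, by ext; simp⟩

lemma range_dualTensorHom_comp {g : M →ₗ[R] N} (hg : g ∈ LinearMap.range (dualTensorHom R M N))
    {M' N' : Type*} [AddCommGroup M'] [Module R M'] [AddCommGroup N'] [Module R N']
    (s : M' →ₗ[R] M) (t : N →ₗ[R] N') :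
    t ∘ₗ g ∘ₗ s ∈ LinearMap.range (dualTensorHom R M' N') := by
  obtain ⟨z, rfl⟩ := hg
  induction z with
  | zero => simp
  | add x y hx hy =>
    rw [map_add, LinearMap.add_comp, LinearMap.comp_add]
    exact add_mem hx hy
  | tmul f n =>
    convert smulRight_mem_range (f ∘ₗ s) (t n) using 1
    ext; simp

/-- Induction on m. Let g be the first coordinate, n ∈ M, l = g(n), and h a functional on the image
of g. The map x ↦ h(l) x - h(g x) n lands in ker g, because h(l) g(x) = h(g x) l. If r is a free
scalar of ker g, then r times this map factors through a finite free module, and so does r h(l) on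
M. Hence the free scalars of M contain the product of two GV ideals: the free scalars of ker g and
the trace ideal of the image. -/
lemma isGV_freeScalars_of_injective [IsNoetherianRing R] [IsIntegrallyClosed R] (m : ℕ) :
    ∀ (M : Type u) [AddCommGroup M] [Module R M] [Module.Finite R M] (f : M →ₗ[R] (Fin m → R)),
      Function.Injective f → IsGV (freeScalars R M) := by
  induction m with
  | zero =>
    intro M _ _ _ f hf
    have : Subsingleton M := hf.subsingleton
    refine isGV_top.mono fun r _ => ?_
    rw [mem_freeScalars, Subsingleton.elim (r • LinearMap.id : M →ₗ[R] M) 0]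
    exact zero_mem _
  | succ m ih =>
    intro M _ _ _ f hf
    let g : M →ₗ[R] R := LinearMap.proj 0 ∘ₗ f
    let t : M →ₗ[R] (Fin m → R) := LinearMap.funLeft R R Fin.succ ∘ₗ f
    have ht : ∀ x, g x = 0 → t x = 0 → x = 0 := fun x h0 h1 => by
      apply hf
      rw [map_zero]
      ext i
      refine Fin.cases h0 (fun i => congrFun h1 i) i
    by_cases hg : g = 0
    · refine ih M t ((injective_iff_map_eq_zero t).2 fun x hx => ht x ?_ hx)
      rw [hg, LinearMap.zero_apply]
    have h1 : IsGV (freeScalars R (LinearMap.ker g)) :=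
      ih _ (t ∘ₗ (LinearMap.ker g).subtype) ((injective_iff_map_eq_zero _).2 fun x hx =>
        Subtype.ext (ht x x.2 hx))
    have h2 : IsGV (traceIdeal R (LinearMap.range g)) := by
      refine isGV_traceIdeal (f := (LinearMap.range g).subtype) fun h => hg ?_
      ext x
      exact LinearMap.congr_fun h (g.rangeRestrict x)
    refine (h1.mul h2).mono (Ideal.mul_le.2 fun r hr s hs => ?_)
    induction hs using Submodule.span_induction with
    | zero => simp
    | add x y _ _ hx hy => rw [mul_add]; exact add_mem hx hy
    | smul c x _ hx => rw [smul_eq_mul, mul_left_comm]; exact Ideal.mul_mem_left _ _ hx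
    | mem s hs =>
      obtain ⟨h, ⟨_, ⟨n, rfl⟩⟩, rfl⟩ := hs
      set l : LinearMap.range g := ⟨g n, n, rfl⟩
      let e : M →ₗ[R] M := (h ∘ₗ g.rangeRestrict).smulRight n
      have he : ∀ x, g (h l • x - e x) = 0 := fun x => by
        have h3 : g n • g.rangeRestrict x = g x • l :=
          Subtype.ext (by simp [l, mul_comm])
        have := congrArg h h3
        rw [map_smul, map_smul, smul_eq_mul, smul_eq_mul] at this
        simp only [map_sub, map_smul, e, LinearMap.smulRight_apply, LinearMap.comp_apply,
          smul_eq_mul, sub_eq_zero]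
        rw [mul_comm (h _) (g n), this, mul_comm]
      let p : M →ₗ[R] LinearMap.ker g := LinearMap.codRestrict _ (h l • LinearMap.id - e) he
      have h4 := range_dualTensorHom_comp hr p (LinearMap.ker g).subtype
      have h5 : r • e ∈ LinearMap.range (dualTensorHom R M M) :=
        Submodule.smul_mem _ _ (smulRight_mem_range _ _)
      rw [mem_freeScalars]
      convert add_mem h4 h5 using 1
      ext x
      change (r * h l) • x = r • (h l • x - e x) + r • e x
      rw [smul_sub, sub_add_cancel, mul_smul]

end GV

/-! ### Finitely generated w-modules over a normal noetherian domain are reflexive -/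

section Reflexive

variable {R : Type u} [CommRing R] [IsDomain R] {M : Type u} [AddCommGroup M] [Module R M]

/-- A finitely generated torsion-free module over a domain embeds into a finite free module. -/
lemma exists_injective_of_isTorsionFree (R : Type u) [CommRing R] [IsDomain R] [IsNoetherianRing R]
    (M : Type u) [AddCommGroup M] [Module R M]
    [Module.Finite R M] [Module.IsTorsionFree R M] :
    ∃ (m : ℕ) (f : M →ₗ[R] (Fin m → R)), Function.Injective f := by
  classical
  obtain ⟨k, s, hs⟩ := Module.Finite.exists_fin (R := R) (M := M)
  -- Every generator has a nonzero multiple in the free span of a maximal independent subfamily.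
  -- Multiplication by the product of these multipliers embeds M into that span.
  obtain ⟨I, hI, hI'⟩ := exists_maximal_linearIndepOn R s
  let N := Submodule.span R (Set.range fun i : I => s i)
  let b : Module.Basis I R N := Module.Basis.span hI
  have hN : ∀ i, ∃ a : R, a ≠ 0 ∧ a • s i ∈ N := fun i => by
    by_cases hi : i ∈ I
    · exact ⟨1, one_ne_zero, by
        rw [one_smul]; exact Submodule.subset_span (Set.mem_range_self (⟨i, hi⟩ : I))⟩
    · obtain ⟨a, ha, h⟩ := hI' i hi
      exact ⟨a, ha, by rwa [Set.image_eq_range] at h⟩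
  choose a ha haN using hN
  have hA : ∏ i, a i ≠ 0 := Finset.prod_ne_zero_iff.2 fun i _ => ha i
  have hmem : ∀ x, LinearMap.lsmul R M (∏ i, a i) x ∈ N := by
    intro x
    have hx : x ∈ Submodule.span R (Set.range s) := hs ▸ trivial
    induction hx using Submodule.span_induction with
    | zero => simp
    | add x y _ _ hx hy => rw [map_add]; exact add_mem hx hy
    | smul c x _ hx => rw [map_smul]; exact N.smul_mem _ hx
    | mem _ hx =>
      obtain ⟨i, rfl⟩ := hx
      rw [LinearMap.lsmul_apply, Fintype.prod_eq_prod_compl_mul i, mul_smul]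
      exact N.smul_mem _ (haN i)
  refine ⟨Fintype.card I, (b.reindex (Fintype.equivFin I)).equivFun.toLinearMap ∘ₗ
    LinearMap.codRestrict N _ hmem, ?_⟩
  rw [LinearMap.coe_comp]
  refine (LinearEquiv.injective _).comp fun x y hxy => ?_
  exact smul_right_injective M hA (congrArg Subtype.val hxy)

lemma isGV_freeScalars [IsNoetherianRing R] [IsIntegrallyClosed R] [Module.Finite R M]
    [Module.IsTorsionFree R M] : IsGV (freeScalars R M) := by
  obtain ⟨m, f, hf⟩ := exists_injective_of_isTorsionFree R M
  exact isGV_freeScalars_of_injective m M f hf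

/-- If r = ∑ f_i ⊗ n_i on M, then rφ is evaluation at ∑ φ(f_i) n_i. So every free scalar multiplies
φ ∈ M^{**} into the image of M. For one nonzero such scalar a, the element representing aφ is
divisible by a, as is seen on the GV ideal of all free scalars. -/
lemma IsWModule.isReflexive [IsNoetherianRing R] [IsIntegrallyClosed R] [Module.Finite R M]
    (hM : IsWModule R M) : Module.IsReflexive R M := by
  have := hM.isTorsionFree
  have hT : IsGV (freeScalars R M) := isGV_freeScalars
  obtain ⟨a, haT, ha⟩ := hT.exists_ne_zero
  have hinj : Function.Injective (Module.Dual.eval R M) := by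
    rw [injective_iff_map_eq_zero]
    intro x hx
    obtain ⟨z, hz⟩ := haT
    have h1 : ∀ z : Module.Dual R M ⊗[R] M, dualTensorHom R M M z x = 0 := fun z => by
      induction z with
      | zero => simp
      | add x y hx hy => simp [hx, hy]
      | tmul f n =>
        have : f x = 0 := LinearMap.congr_fun hx f
        simp [this]
    have h2 : a • x = 0 := by
      rw [← h1 z, hz]; simp
    simpa [ha] using h2
  refine ⟨hinj, fun φ => ?_⟩
  have key : ∀ r ∈ freeScalars R M, ∃ m, Module.Dual.eval R M m = r • φ := by
    rintro r ⟨z, hz⟩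
    have h1 : ∀ z : Module.Dual R M ⊗[R] M,
        ∃ m, ∀ f : Module.Dual R M, f m = φ (f ∘ₗ dualTensorHom R M M z) := fun z => by
      induction z with
      | zero => exact ⟨0, by simp⟩
      | add x y hx hy =>
        obtain ⟨m, hm⟩ := hx
        obtain ⟨m', hm'⟩ := hy
        exact ⟨m + m', fun f => by rw [map_add, hm, hm', map_add, LinearMap.comp_add, map_add]⟩
      | tmul g n =>
        refine ⟨φ g • n, fun f => ?_⟩
        have : f ∘ₗ dualTensorHom R M M (g ⊗ₜ n) = f n • g := by
          ext x; simp [mul_comm]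
        rw [this, map_smul, map_smul, smul_eq_mul, smul_eq_mul, mul_comm]
    obtain ⟨m, hm⟩ := h1 z
    refine ⟨m, ?_⟩
    ext f
    rw [Module.Dual.eval_apply, hm, hz]
    change φ (f ∘ₗ (r • LinearMap.id)) = r • φ f
    rw [LinearMap.comp_smul, LinearMap.comp_id, map_smul]
  obtain ⟨y, hy⟩ := key a haT
  obtain ⟨m, hm⟩ := hM.exists_eq_smul hT ha (y := y) fun r hr => by
    obtain ⟨z, hz⟩ := key r hr
    refine ⟨z, hinj ?_⟩
    rw [map_smul, map_smul, hy, hz, smul_comm]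
  refine ⟨m, ?_⟩
  apply smul_right_injective _ ha
  change a • _ = a • φ
  rw [← map_smul, ← hm, hy]

end Reflexive

/-! ### Depth and Cohen-Macaulay modules -/

section Depth

variable {A : Type u} [CommRing A] [IsLocalRing A]

lemma exists_isRegular_of_le_depth {M : Type u} [AddCommGroup M] [Module A M] [Nontrivial M] {n : ℕ}
    (h : (n : ℕ∞) ≤ depth A M) : ∃ rs : List A, n ≤ rs.length ∧
      (∀ r ∈ rs, r ∈ IsLocalRing.maximalIdeal A) ∧ RingTheory.Sequence.IsRegular M rs := by
  rcases n with _ | n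
  · exact ⟨[], le_rfl, by simp, RingTheory.Sequence.IsRegular.nil A M⟩
  · have h1 : (n : ℕ∞) < depth A M := lt_of_lt_of_le (by exact_mod_cast n.lt_succ_self) h
    obtain ⟨rs, hrs⟩ := lt_iSup_iff.1 h1
    exact ⟨rs.1, by exact_mod_cast Order.add_one_le_of_lt hrs, rs.2.1, rs.2.2⟩

variable [IsNoetherianRing A] {M : Type u} [AddCommGroup M] [Module A M] [Module.Finite A M]

/-- Cutting by a regular sequence lowers the dimension of the support by its length, and that
dimension is at most dim A. -/
lemma depth_le_ringKrullDim [Nontrivial M] :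
    (depth A M : WithBot ℕ∞) ≤ ringKrullDim A := by
  obtain ⟨d, hd⟩ := WithBot.ne_bot_iff_exists.1 (ringKrullDim_ne_bot (R := A))
  rw [← hd, WithBot.coe_le_coe]
  refine iSup_le fun rs => ?_
  have h1 := Module.supportDim_add_length_eq_supportDim_of_isRegular rs.1 rs.2.2
  have h2 := Module.supportDim_le_ringKrullDim A M
  have h3 := rs.2.2.quot_ofList_smul_nontrivial
  obtain ⟨e, he⟩ := WithBot.ne_bot_iff_exists.1 (Module.supportDim_ne_bot_of_nontrivial A
    (M ⧸ Ideal.ofList rs.1 • (⊤ : Submodule A M)))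
  rw [← h1, ← hd, ← he] at h2
  have h4 : e + (rs.1.length : ℕ∞) ≤ d := by exact_mod_cast h2
  exact le_trans le_add_self h4

/-- Rees' characterization of depth. Nakayama gives 𝔪M ≠ M, and the support of the residue field is
V(𝔪). -/
lemma le_depth_iff [Nontrivial M] (n : ℕ) : (n : ℕ∞) ≤ depth A M ↔
    ∀ i < n, Subsingleton (Abelian.Ext.{u} (ModuleCat.of A (IsLocalRing.ResidueField A))
      (ModuleCat.of A M) i) := by
  have hlt : IsLocalRing.maximalIdeal A • (⊤ : Submodule A M) < ⊤ :=
    (Submodule.top_ne_ideal_smul_of_le_jacobson_annihilator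
      (IsLocalRing.maximalIdeal_le_jacobson _)).symm.lt_top
  have hsupp : Module.support A (IsLocalRing.ResidueField A) =
      PrimeSpectrum.zeroLocus (IsLocalRing.maximalIdeal A) := by
    change Module.support A (A ⧸ IsLocalRing.maximalIdeal A) = _
    rw [Module.support_eq_zeroLocus, Ideal.annihilator_quotient]
  have : Module.Finite A (ModuleCat.of A (IsLocalRing.ResidueField A)) :=
    inferInstanceAs (Module.Finite A (A ⧸ IsLocalRing.maximalIdeal A))
  constructor
  · intro h i hi
    obtain ⟨rs, hlen, hmem, hreg⟩ := exists_isRegular_of_le_depth h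
    exact ModuleCat.subsingleton_ext_of_exists_isRegular (IsLocalRing.maximalIdeal A)
      (ModuleCat.of A (IsLocalRing.ResidueField A)) hsupp.subset (ModuleCat.of A M) hlt rs hmem hreg
      i (hi.trans_le hlen)
  · intro h
    obtain ⟨rs, hlen, hmem, hreg⟩ := ModuleCat.exists_isRegular_of_exists_subsingleton_ext
      (IsLocalRing.maximalIdeal A) n (ModuleCat.of A M) hlt
      (ModuleCat.of A (IsLocalRing.ResidueField A)) hsupp h
    rw [← hlen]
    exact le_iSup (fun rs : {rs : List A // (∀ r ∈ rs, r ∈ IsLocalRing.maximalIdeal A) ∧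
      RingTheory.Sequence.IsRegular M rs} => (rs.1.length : ℕ∞)) ⟨rs, hmem, hreg⟩

lemma depth_eq_ringKrullDim_iff [Nontrivial M] :
    (depth A M : WithBot ℕ∞) = ringKrullDim A ↔ ∀ i : ℕ, (i : WithBot ℕ∞) < ringKrullDim A →
      Subsingleton (Abelian.Ext.{u} (ModuleCat.of A (IsLocalRing.ResidueField A))
        (ModuleCat.of A M) i) := by
  constructor
  · intro h i hi
    rw [← h] at hi
    have hi' : (i : ℕ∞) < depth A M := by exact_mod_cast hi
    exact (le_depth_iff (i + 1)).1 (by exact_mod_cast Order.add_one_le_of_lt hi') i i.lt_succ_self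
  · intro h
    refine le_antisymm depth_le_ringKrullDim ?_
    obtain ⟨d, hd⟩ := WithBot.ne_bot_iff_exists.1 (ringKrullDim_ne_bot (R := A))
    rw [← hd] at h ⊢
    rw [WithBot.coe_le_coe]
    refine ENat.forall_natCast_le_iff_le.1 fun n hn => (le_depth_iff n).2 fun i hi => h i ?_
    have : (i : ℕ∞) < d := lt_of_lt_of_le (by exact_mod_cast hi) hn
    exact_mod_cast this

end Depth

/-! ### Cohen-Macaulayness as Ext vanishing: direct summands and finite products -/

section Additive

variable {A : Type u} [Ring A] {J : Type*} [Fintype J]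

/-- Ext is additive in its second argument, so each class on Y is a sum of classes that pass through
the vanishing groups of the Z_j. -/
lemma subsingleton_ext_of_sum_comp_eq_id {X Y : ModuleCat.{u} A} {Z : J → ModuleCat.{u} A}
    (f : ∀ j, Y ⟶ Z j) (g : ∀ j, Z j ⟶ Y) (h : ∑ j, f j ≫ g j = 𝟙 Y) (i : ℕ)
    (hZ : ∀ j, Subsingleton (Abelian.Ext.{u} X (Z j) i)) : Subsingleton (Abelian.Ext.{u} X Y i) := by
  refine subsingleton_of_forall_eq 0 fun x => ?_
  rw [← x.comp_mk₀_id, ← h, Abelian.Ext.mk₀_sum, Abelian.Ext.comp_sum]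
  refine Finset.sum_eq_zero fun j _ => ?_
  rw [← Abelian.Ext.mk₀_comp_mk₀, ← Abelian.Ext.comp_assoc_of_second_deg_zero,
    Subsingleton.elim (x.comp (Abelian.Ext.mk₀ (f j)) (add_zero i)) 0, Abelian.Ext.zero_comp]

end Additive

section CM

variable {R : Type u} [CommRing R] [IsNoetherianRing R]

/-- Outside the support the localization is zero, so the Ext condition can be asked at all primes.
In this form it is visibly inherited by summands and finite products, whose supports may differ. -/
lemma isCM_iff {M : Type u} [AddCommGroup M] [Module R M] :
    IsCM R M ↔ Module.Finite R M ∧ ∀ (p : PrimeSpectrum R) (i : ℕ),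
      (i : WithBot ℕ∞) < ringKrullDim (Localization.AtPrime p.asIdeal) →
        Subsingleton (Abelian.Ext.{u}
          (ModuleCat.of (Localization.AtPrime p.asIdeal)
            (IsLocalRing.ResidueField (Localization.AtPrime p.asIdeal)))
          (ModuleCat.of (Localization.AtPrime p.asIdeal)
            (LocalizedModule p.asIdeal.primeCompl M)) i) := by
  have key : ∀ (_ : Module.Finite R M) (p : PrimeSpectrum R), p ∈ Module.support R M →
      ((depth (Localization.AtPrime p.asIdeal) (LocalizedModule p.asIdeal.primeCompl M) :
        WithBot ℕ∞) = ringKrullDim (Localization.AtPrime p.asIdeal) ↔ ∀ i : ℕ,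
      (i : WithBot ℕ∞) < ringKrullDim (Localization.AtPrime p.asIdeal) →
        Subsingleton (Abelian.Ext.{u}
          (ModuleCat.of (Localization.AtPrime p.asIdeal)
            (IsLocalRing.ResidueField (Localization.AtPrime p.asIdeal)))
          (ModuleCat.of (Localization.AtPrime p.asIdeal)
            (LocalizedModule p.asIdeal.primeCompl M)) i)) := by
    intro _ p hp
    have : Nontrivial (LocalizedModule p.asIdeal.primeCompl M) := hp
    have : IsNoetherianRing (Localization.AtPrime p.asIdeal) :=
      IsLocalization.isNoetherianRing p.asIdeal.primeCompl _ inferInstance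
    exact depth_eq_ringKrullDim_iff
  constructor
  · rintro ⟨hfin, h⟩
    refine ⟨hfin, fun p => ?_⟩
    by_cases hp : p ∈ Module.support R M
    · exact (key hfin p hp).1 (h p hp)
    · intro i _
      have : Subsingleton (LocalizedModule p.asIdeal.primeCompl M) :=
        not_nontrivial_iff_subsingleton.1 hp
      -- The identity of the zero module is the empty sum.
      refine subsingleton_ext_of_sum_comp_eq_id (J := Empty) (Z := fun _ => ModuleCat.of _ PUnit)
        (fun j => j.elim) (fun j => j.elim) ?_ i (fun j => j.elim)
      ext x
      exact Subsingleton.elim (α := LocalizedModule p.asIdeal.primeCompl M) _ _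
  · rintro ⟨hfin, h⟩
    exact ⟨hfin, fun p hp => (key hfin p hp).2 (h p)⟩

/-- If the identity of `M` is a sum of endomorphisms which factor through Cohen-Macaulay modules,
then `M` is Cohen-Macaulay. -/
lemma IsCM.of_sum_comp_eq_id {J : Type*} [Fintype J] {M : Type u} [AddCommGroup M] [Module R M]
    {N : J → Type u} [∀ j, AddCommGroup (N j)] [∀ j, Module R (N j)] (hN : ∀ j, IsCM R (N j))
    (f : ∀ j, M →ₗ[R] N j) (g : ∀ j, N j →ₗ[R] M) (h : ∀ x, ∑ j, g j (f j x) = x) : IsCM R M := by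
  rw [isCM_iff]
  constructor
  · have := fun j => (hN j).finite
    refine Module.Finite.of_surjective (∑ j, g j ∘ₗ LinearMap.proj j) fun x => ⟨fun j => f j x, ?_⟩
    simp [h]
  · intro p i hi
    refine subsingleton_ext_of_sum_comp_eq_id
      (Z := fun j => ModuleCat.of _ (LocalizedModule p.asIdeal.primeCompl (N j)))
      (fun j => ModuleCat.ofHom (LocalizedModule.map p.asIdeal.primeCompl (f j)))
      (fun j => ModuleCat.ofHom (LocalizedModule.map p.asIdeal.primeCompl (g j))) ?_ i
      fun j => (isCM_iff.1 (hN j)).2 p i hi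
    ext x
    rw [ModuleCat.hom_sum, LinearMap.sum_apply]
    induction x using LocalizedModule.induction_on with
    | h m s =>
      have h1 : ∑ j, g j ∘ₗ f j = LinearMap.id := by
        ext x; simp [h]
      have h2 := LinearMap.congr_fun (congrArg (LocalizedModule.map p.asIdeal.primeCompl) h1)
        (LocalizedModule.mk m s)
      rw [map_sum, LinearMap.sum_apply] at h2
      simp only [LocalizedModule.map_mk, LinearMap.comp_apply, LinearMap.id_apply] at h2
      change ∑ j, LocalizedModule.map p.asIdeal.primeCompl (g j)
        (LocalizedModule.map p.asIdeal.primeCompl (f j) (LocalizedModule.mk m s)) =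
          LocalizedModule.mk m s
      simpa only [LocalizedModule.map_mk] using h2

lemma IsCM.of_linearEquiv {M N : Type u} [AddCommGroup M] [Module R M] [AddCommGroup N]
    [Module R N] (hN : IsCM R N) (e : M ≃ₗ[R] N) : IsCM R M :=
  IsCM.of_sum_comp_eq_id (J := Unit) (N := fun _ => N) (fun _ => hN) (fun _ => e.toLinearMap)
    (fun _ => e.symm.toLinearMap) (by simp)

lemma isCM_congr {M N : Type u} [AddCommGroup M] [Module R M] [AddCommGroup N]
    [Module R N] (e : M ≃ₗ[R] N) : IsCM R M ↔ IsCM R N :=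
  ⟨fun h => h.of_linearEquiv e.symm, fun h => h.of_linearEquiv e⟩

lemma isCM_pi_iff {J : Type} [Fintype J] {N : J → Type u} [∀ j, AddCommGroup (N j)]
    [∀ j, Module R (N j)] : IsCM R (∀ j, N j) ↔ ∀ j, IsCM R (N j) := by
  classical
  constructor
  · intro h j
    exact IsCM.of_sum_comp_eq_id (J := Unit) (N := fun _ => ∀ j, N j) (fun _ => h)
      (fun _ => LinearMap.single R N j) (fun _ => LinearMap.proj j) (by simp)
  · intro h
    refine IsCM.of_sum_comp_eq_id h (fun j => LinearMap.proj j) (LinearMap.single R N) fun x => ?_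
    simp [LinearMap.single_apply, Finset.univ_sum_single]

end CM

/-! ### Cohen-Macaulay modules over a normal domain are w-modules -/

section Normal

variable {R : Type u} [CommRing R] [IsNoetherianRing R] [IsDomain R]

lemma one_le_ringKrullDim_localization {p : Ideal R} [p.IsPrime] (hp : p ≠ ⊥) :
    1 ≤ ringKrullDim (Localization.AtPrime p) := by
  by_contra h
  have : Ring.KrullDimLE 0 (Localization.AtPrime p) := by
    rw [Ring.krullDimLE_iff]
    obtain ⟨d, hd⟩ := WithBot.ne_bot_iff_exists.1
      (ringKrullDim_ne_bot (R := Localization.AtPrime p))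
    rw [← hd] at h ⊢
    have h' : ¬ (1 : ℕ∞) ≤ d := fun h2 => h (by exact_mod_cast h2)
    have : d = 0 := by simpa using h'
    simp [this]
  have hf : IsField (Localization.AtPrime p) := Ring.KrullDimLE.isField_of_isDomain
  obtain ⟨r, hr, hr0⟩ := Submodule.exists_mem_ne_zero_of_ne_bot hp
  have h1 : algebraMap R (Localization.AtPrime p) r ∈
      IsLocalRing.maximalIdeal (Localization.AtPrime p) :=
    (IsLocalization.AtPrime.to_map_mem_maximal_iff _ p r).2 hr
  rw [IsLocalRing.isField_iff_maximalIdeal_eq.1 hf, Ideal.mem_bot] at h1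
  exact hr0 ((IsLocalization.injective _ p.primeCompl_le_nonZeroDivisors)
    (h1.trans (map_zero _).symm))

/-- In dimension at most one, normality makes the maximal ideal of R_p principal. Clearing
denominators in its generator gives t₀ ∈ p and s ∉ p with t₀ ∣ s r for all r ∈ p. The GV property
then yields t₀ ∣ s, which contradicts s ∉ p. -/
lemma two_le_ringKrullDim_localization [IsIntegrallyClosed R] {p : Ideal R} [p.IsPrime]
    (hp : IsGV p) : 2 ≤ ringKrullDim (Localization.AtPrime p) := by
  by_contra h
  have : Ring.KrullDimLE 1 (Localization.AtPrime p) := by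
    rw [Ring.krullDimLE_iff]
    obtain ⟨d, hd⟩ := WithBot.ne_bot_iff_exists.1
      (ringKrullDim_ne_bot (R := Localization.AtPrime p))
    rw [← hd] at h ⊢
    have h' : ¬ (2 : ℕ∞) ≤ d := fun h2 => h (WithBot.coe_le_coe.2 h2)
    have : d ≤ 1 := Order.le_of_lt_add_one (by rw [one_add_one_eq_two]; exact not_le.1 h')
    exact_mod_cast this
  have : IsNoetherianRing (Localization.AtPrime p) :=
    IsLocalization.isNoetherianRing p.primeCompl _ inferInstance
  have : IsIntegrallyClosed (Localization.AtPrime p) :=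
    isIntegrallyClosed_of_isLocalization _ p.primeCompl p.primeCompl_le_nonZeroDivisors
  have hprinc : (IsLocalRing.maximalIdeal (Localization.AtPrime p)).IsPrincipal :=
    ((tfae_of_isNoetherianRing_of_isLocalRing_of_isDomain (Localization.AtPrime p)).out 3 4
      rfl rfl).1
      ⟨inferInstance, fun P hP hP' => IsLocalRing.eq_maximalIdeal (hP'.isMaximal_of_ne_bot hP)⟩
  obtain ⟨t, ht⟩ := hprinc
  have htm : t ∈ IsLocalRing.maximalIdeal (Localization.AtPrime p) := by
    rw [ht]; exact Submodule.mem_span_singleton_self t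
  obtain ⟨t₀, s₀, rfl⟩ := IsLocalization.exists_mk'_eq p.primeCompl t
  rw [IsLocalization.AtPrime.mk'_mem_maximal_iff _ p] at htm
  have hdiv : ∀ r ∈ p, ∃ s ∉ p, t₀ ∣ s * r := by
    intro r hr
    have h1 : algebraMap R (Localization.AtPrime p) r ∈
        IsLocalRing.maximalIdeal (Localization.AtPrime p) :=
      (IsLocalization.AtPrime.to_map_mem_maximal_iff _ p r).2 hr
    rw [ht, Submodule.mem_span_singleton] at h1
    obtain ⟨c, hc⟩ := h1
    obtain ⟨c, u, rfl⟩ := IsLocalization.exists_mk'_eq p.primeCompl c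
    rw [smul_eq_mul, ← IsLocalization.mk'_mul, IsLocalization.mk'_eq_iff_eq_mul, ← map_mul] at hc
    have hc' := IsLocalization.injective _ p.primeCompl_le_nonZeroDivisors hc
    refine ⟨(u * s₀ : p.primeCompl), (u * s₀).2, c, ?_⟩
    rw [mul_comm, ← hc', mul_comm]
  obtain ⟨G, hG⟩ := (isNoetherianRing_iff_ideal_fg R).1 inferInstance p
  choose! s hs hs' using hdiv
  have hGp : ∀ g ∈ G, g ∈ p := fun g hg => hG ▸ Submodule.subset_span hg
  -- As p is finitely generated, one multiplier outside p serves all of its elements.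
  have hsG : ∏ g ∈ G, s g ∉ p := fun h => by
    obtain ⟨g, hg, hgs⟩ := (Ideal.IsPrime.prod_mem_iff).1 h
    exact hs g (hGp g hg) hgs
  have ht₀ : t₀ ≠ 0 := by
    rintro rfl
    obtain ⟨r, hr, hr0⟩ := hp.exists_ne_zero
    have := hs' r hr
    rw [zero_dvd_iff, mul_eq_zero] at this
    exact this.elim (fun h => hs r hr (h ▸ zero_mem p)) hr0
  refine hsG (Ideal.mem_of_dvd _ (hp.2 t₀ _ ht₀ fun r hr => ?_) htm)
  rw [← hG] at hr
  induction hr using Submodule.span_induction with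
  | zero => simp
  | add x y _ _ hx hy => rw [add_mul]; exact dvd_add hx hy
  | smul c x _ hx => rw [smul_eq_mul, mul_assoc]; exact hx.mul_left c
  | mem g hg =>
    have := (hs' g (hGp g hg)).trans
      (mul_dvd_mul_right (Finset.dvd_prod_of_mem s hg) g)
    rwa [mul_comm] at this

variable {M : Type u} [AddCommGroup M] [Module R M]

lemma IsCM.exists_isRegular (hM : IsCM R M) {p : Ideal R} [p.IsPrime] {x : M}
    (hx : ∀ s, s • x = 0 → s ∈ p) {n : ℕ}
    (hn : (n : WithBot ℕ∞) ≤ ringKrullDim (Localization.AtPrime p)) :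
    ∃ rs : List (Localization.AtPrime p), n ≤ rs.length ∧
      (∀ r ∈ rs, r ∈ IsLocalRing.maximalIdeal (Localization.AtPrime p)) ∧
      RingTheory.Sequence.IsRegular (LocalizedModule p.primeCompl M) rs := by
  have hnt : Nontrivial (LocalizedModule p.primeCompl M) := by
    refine ⟨LocalizedModule.mk x 1, 0, fun h => ?_⟩
    rw [← LocalizedModule.zero_mk 1, LocalizedModule.mk_eq] at h
    obtain ⟨u, hu⟩ := h
    refine u.2 (hx u ?_)
    simpa [Submonoid.smul_def] using hu
  have h1 := hM.depth_eq ⟨p, inferInstance⟩ hnt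
  have h2 : (n : WithBot ℕ∞) ≤ (depth (Localization.AtPrime p) (LocalizedModule p.primeCompl M) :
    WithBot ℕ∞) := hn.trans h1.ge
  exact exists_isRegular_of_le_depth (by exact_mod_cast h2)

/-- A torsion element gives a nonzero associated prime P of M. Then dim R_P ≥ 1, so some element of
the maximal ideal of R_P is regular on M_P, yet it kills the element with annihilator P. -/
lemma IsCM.isTorsionFree (hM : IsCM R M) : Module.IsTorsionFree R M := by
  rw [Module.isTorsionFree_iff_smul_eq_zero]
  intro a x hax
  by_contra! hne
  obtain ⟨ha, hx⟩ := hne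
  obtain ⟨P, hP, hle⟩ := exists_le_isAssociatedPrime_of_isNoetherianRing R x hx
  obtain ⟨hPp, y, hy⟩ := isAssociatedPrime_iff.1 hP
  have hmem : ∀ s, s ∈ P ↔ s • y = 0 := fun s => by
    rw [hy, Submodule.mem_colon_singleton, Submodule.mem_bot]
  have haP : a ∈ P := hle (by rw [Submodule.mem_colon_singleton, hax]; exact zero_mem _)
  have hP0 : P ≠ ⊥ := fun h => ha (by rw [h] at haP; exact haP)
  obtain ⟨rs, hlen, hm, hreg⟩ := hM.exists_isRegular (fun s hs => (hmem s).2 hs) (n := 1)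
    (by exact_mod_cast one_le_ringKrullDim_localization hP0)
  obtain _ | ⟨u, rs⟩ := rs
  · simp at hlen
  have hu := hm u (by simp)
  have hureg := ((RingTheory.Sequence.isRegular_cons_iff _ u rs).1 hreg).1
  obtain ⟨b, s, rfl⟩ := IsLocalization.exists_mk'_eq P.primeCompl u
  rw [IsLocalization.AtPrime.mk'_mem_maximal_iff _ P] at hu
  have h0 : LocalizedModule.mk y (1 : P.primeCompl) = 0 := by
    apply hureg
    change _ • _ = _ • _
    rw [← Localization.mk_eq_mk', LocalizedModule.mk_smul_mk, (hmem b).1 hu, LocalizedModule.zero_mk, smul_zero]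
  rw [← LocalizedModule.zero_mk 1, LocalizedModule.mk_eq] at h0
  obtain ⟨v, hv⟩ := h0
  refine v.2 ((hmem v).2 ?_)
  simpa [Submonoid.smul_def] using hv

/-- If y ∉ aM, an associated prime P of M/aM contains J, so P is GV and M_P has a regular sequence
u, v. Let P be the annihilator of the class of z. From uz = aw and vz = aw' follows vw = uw', so w =
ux and z = ax in M_P, which puts an element outside P into the annihilator of that class. -/
lemma IsCM.isWModule [IsIntegrallyClosed R] (hM : IsCM R M) : IsWModule R M where
  isTorsionFree := hM.isTorsionFree
  exists_eq_smul {J} hJ {a} ha {y} H := by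
    have := hM.isTorsionFree
    by_contra hy
    let Q : Submodule R M := LinearMap.range (LinearMap.lsmul R M a)
    have hQ : ∀ z, z ∈ Q ↔ ∃ w, z = a • w := fun z => by
      simp [Q, LinearMap.mem_range, eq_comm]
    have hyQ : Q.mkQ y ≠ 0 := by
      rw [Submodule.mkQ_apply, ne_eq, Submodule.Quotient.mk_eq_zero, hQ]
      exact hy
    obtain ⟨P, hP, hle⟩ := exists_le_isAssociatedPrime_of_isNoetherianRing R _ hyQ
    obtain ⟨hPp, z, hz⟩ := isAssociatedPrime_iff.1 hP
    obtain ⟨z, rfl⟩ := Q.mkQ_surjective z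
    have hmem : ∀ s, s ∈ P ↔ ∃ w, s • z = a • w := fun s => by
      rw [hz, Submodule.mem_colon_singleton, Submodule.mem_bot, ← map_smul, Submodule.mkQ_apply,
        Submodule.Quotient.mk_eq_zero, hQ]
    have hPGV : IsGV P := hJ.mono fun r hr => hle (by
      rw [Submodule.mem_colon_singleton, Submodule.mem_bot, ← map_smul, Submodule.mkQ_apply,
        Submodule.Quotient.mk_eq_zero, hQ]
      exact H r hr)
    obtain ⟨rs, hlen, hm, hreg⟩ := hM.exists_isRegular (x := z)
      (fun s hs => (hmem s).2 ⟨0, by rw [hs, smul_zero]⟩) (n := 2)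
      (by exact_mod_cast two_le_ringKrullDim_localization hPGV)
    obtain _ | ⟨u, _ | ⟨v, rs⟩⟩ := rs
    · simp at hlen
    · simp at hlen
    have hu := hm u (by simp)
    have hv := hm v (by simp)
    rw [RingTheory.Sequence.isRegular_cons_iff, RingTheory.Sequence.isRegular_cons_iff] at hreg
    obtain ⟨hureg, hvreg, -⟩ := hreg
    have haM : Function.Injective fun x : LocalizedModule P.primeCompl M => a • x := by
      intro x x' h
      have ha' : algebraMap R (Localization.AtPrime P) a ≠ 0 := fun h0 => ha
        ((IsLocalization.injective _ P.primeCompl_le_nonZeroDivisors) (h0.trans (map_zero _).symm))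
      refine smul_right_injective (LocalizedModule P.primeCompl M) ha' ?_
      simpa only [algebraMap_smul] using h
    have hdiv : ∀ u ∈ IsLocalRing.maximalIdeal (Localization.AtPrime P),
        ∃ w : LocalizedModule P.primeCompl M, u • LocalizedModule.mk z 1 = a • w := by
      intro u hu
      obtain ⟨b, s, rfl⟩ := IsLocalization.exists_mk'_eq P.primeCompl u
      rw [IsLocalization.AtPrime.mk'_mem_maximal_iff _ P] at hu
      obtain ⟨w, hw⟩ := (hmem b).1 hu
      exact ⟨LocalizedModule.mk w s, by
        rw [← Localization.mk_eq_mk', LocalizedModule.mk_smul_mk, hw, mul_one, LocalizedModule.smul'_mk]⟩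
    obtain ⟨w, hw⟩ := hdiv u hu
    obtain ⟨w', hw'⟩ := hdiv v hv
    have h1 : v • w = u • w' := by
      apply haM
      change a • v • w = a • u • w'
      rw [smul_comm a v, smul_comm a u, ← hw, ← hw', smul_comm]
    have h2 : Submodule.Quotient.mk w = (0 : QuotSMulTop u (LocalizedModule P.primeCompl M)) := by
      apply hvreg
      change v • _ = v • _
      rw [smul_zero, ← Submodule.Quotient.mk_smul, Submodule.Quotient.mk_eq_zero, h1]
      exact Submodule.smul_mem_pointwise_smul _ _ _ trivial
    rw [Submodule.Quotient.mk_eq_zero] at h2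
    obtain ⟨x, -, hx⟩ := h2
    have h3 : LocalizedModule.mk z (1 : P.primeCompl) = a • x := by
      apply hureg
      change u • _ = u • a • x
      rw [hw, ← hx]
      exact smul_comm _ _ _
    induction x using LocalizedModule.induction_on with
    | h m s =>
      rw [LocalizedModule.smul'_mk, LocalizedModule.mk_eq] at h3
      obtain ⟨c, hc⟩ := h3
      refine (c * s).2 ((hmem _).2 ⟨c • m, ?_⟩)
      simp only [one_smul, Submonoid.smul_def] at hc ⊢
      rw [Submonoid.coe_mul, mul_smul, hc, smul_comm]

end Normal

/-! ### Projections of a graded module -/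

section Projections

variable {ι : Type} [AddCommGroup ι] [Fintype ι] [DecidableEq ι] {M : Type*} [AddCommGroup M]

/-- The family of projections onto the components of an internal direct sum decomposition. -/
structure IsProjections (ℳ : ι → AddSubgroup M) (p : ι → M →+ M) : Prop where
  mem : ∀ i x, p i x ∈ ℳ i
  eq_self : ∀ i, ∀ x ∈ ℳ i, p i x = x
  eq_zero : ∀ i j, i ≠ j → ∀ x ∈ ℳ i, p j x = 0
  sum_eq : ∀ x, ∑ i, p i x = x

lemma IsProjections.apply_eq_ite {ℳ : ι → AddSubgroup M} {p : ι → M →+ M} (h : IsProjections ℳ p)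
    {i : ι} (j : ι) {x : M} (hx : x ∈ ℳ i) : p j x = if i = j then x else 0 := by
  split_ifs with hij
  · subst hij; exact h.eq_self i x hx
  · exact h.eq_zero i j hij x hx

lemma IsProjections.isInternal {ℳ : ι → AddSubgroup M} {p : ι → M →+ M} (h : IsProjections ℳ p) :
    DirectSum.IsInternal ℳ := by
  constructor
  · rw [injective_iff_map_eq_zero]
    intro v hv
    rw [← DirectSum.sum_univ_of v, map_sum] at hv
    simp only [DirectSum.coeAddMonoidHom_of] at hv
    ext j
    have h1 := congrArg (p j) hv
    rw [map_sum, map_zero] at h1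
    simp only [fun i => h.apply_eq_ite j (v i).2] at h1
    simpa using h1
  · intro x
    refine ⟨∑ i, DirectSum.of (fun i => ℳ i) i ⟨p i x, h.mem i x⟩, ?_⟩
    rw [map_sum]
    simp only [DirectSum.coeAddMonoidHom_of]
    exact h.sum_eq x

lemma exists_isProjections {ℳ : ι → AddSubgroup M} (h : DirectSum.IsInternal ℳ) :
    ∃ p, IsProjections ℳ p := by
  let := h.chooseDecomposition
  refine ⟨fun i => (ℳ i).subtype.comp ((DFinsupp.evalAddMonoidHom i).comp
    (DirectSum.decomposeAddEquiv ℳ).toAddMonoidHom), fun i x => (DirectSum.decompose ℳ x i).2,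
    fun i x hx => DirectSum.decompose_of_mem_same ℳ hx,
    fun i j hij x hx => DirectSum.decompose_of_mem_ne ℳ hx hij, fun x => ?_⟩
  have h1 := congrArg (DirectSum.coeAddMonoidHom ℳ) (DirectSum.sum_univ_of (DirectSum.decompose ℳ x))
  rw [map_sum] at h1
  simp only [DirectSum.coeAddMonoidHom_of] at h1
  exact h1.trans ((DirectSum.decompose ℳ).symm_apply_apply x)

end Projections

/-! ### Graded modules as modules over a smash product -/

section Smash

variable {ι : Type} [AddCommGroup ι] [Fintype ι] [DecidableEq ι]
  {R : Type u} [CommRing R] {A B : Type u} [Ring A] [Ring B] [Algebra R A] [Algebra R B]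

lemma sum_comp_neg {M : Type*} [AddCommMonoid M] (f : ι → M) : ∑ i, f (-i) = ∑ i, f i :=
  Equiv.sum_comp (Equiv.neg ι) f

/-- The ring `B` is a smash product of the `ι`-graded ring `A` with the dual of the group `ι`: it
contains orthogonal idempotents `e_i` with sum `1` such that `e_i B e_j` is the component of `A` of
degree `j - i`. -/
structure IsSmashProduct (𝒜 : ι → AddSubgroup A) (ρ : A →ₐ[R] B) (e : ι → B) : Prop where
  mul_mem : ∀ {i j a b}, a ∈ 𝒜 i → b ∈ 𝒜 j → a * b ∈ 𝒜 (i + j)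
  one_mem : 1 ∈ 𝒜 0
  exists_sum : ∀ a, ∃ c : ι → A, (∀ g, c g ∈ 𝒜 g) ∧ ∑ g, c g = a
  mul_self : ∀ i, e i * e i = e i
  mul_of_ne : ∀ i j, i ≠ j → e i * e j = 0
  sum_eq : ∑ i, e i = 1
  e_mul : ∀ {g a}, a ∈ 𝒜 g → ∀ i, e i * ρ a = ρ a * e (i + g)
  exists_mem : ∀ i j b, ∃ a ∈ 𝒜 (j - i), e i * ρ a = e i * b * e j
  eq_zero : ∀ {i g a}, a ∈ 𝒜 g → e i * ρ a = 0 → a = 0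

namespace IsSmashProduct

variable {𝒜 : ι → AddSubgroup A} {ρ : A →ₐ[R] B} {e : ι → B} (h : IsSmashProduct 𝒜 ρ e)

include h

section Functor

variable (Y : Type u) [AddCommGroup Y] [Module B Y]

/-- The grading of a `B`-module. -/
def degree (_ : IsSmashProduct 𝒜 ρ e) (Y : Type u) [AddCommGroup Y] [Module B Y] (i : ι) :
    AddSubgroup Y where
  -- The sign comes from e_i ρ(a) = ρ(a) e_{i+g} for a of degree g: left multiplication by ρ(a)
  -- lowers the index of the idempotent by g.
  carrier := {y | e (-i) • y = y}
  zero_mem' := smul_zero _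
  add_mem' := fun {x y} hx hy => by
    change _ • (x + y) = _
    rw [smul_add, hx, hy]
  neg_mem' := fun {x} hx => by
    change _ • (-x) = _
    rw [smul_neg, hx]

lemma mem_degree {Y : Type u} [AddCommGroup Y] [Module B Y] {i : ι} {y : Y} :
    y ∈ h.degree Y i ↔ e (-i) • y = y := Iff.rfl

lemma isProjections_degree :
    IsProjections (h.degree Y) fun i => DistribSMul.toAddMonoidHom Y (e (-i)) where
  mem i x := by
    rw [h.mem_degree, DistribSMul.toAddMonoidHom_apply, ← mul_smul, h.mul_self]
  eq_self i x hx := hx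
  eq_zero i j hij x hx := by
    rw [DistribSMul.toAddMonoidHom_apply, ← h.mem_degree.1 hx, ← mul_smul,
      h.mul_of_ne _ _ fun h' => hij (neg_injective h').symm, zero_smul]
  sum_eq x := by
    simp only [DistribSMul.toAddMonoidHom_apply]
    rw [← Finset.sum_smul, sum_comp_neg e, h.sum_eq, one_smul]

lemma smul_mem_degree {i j : ι} {a : A} {x : Y} (ha : a ∈ 𝒜 i) (hx : x ∈ h.degree Y j) :
    ρ a • x ∈ h.degree Y (i + j) := by
  rw [h.mem_degree, ← mul_smul, h.e_mul ha, mul_smul]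
  rw [show -(i + j) + i = -j by abel, h.mem_degree.1 hx]

/-- The graded `A`-module underlying a `B`-module. -/
noncomputable def toGraded (Y : ModuleCat.{u} B) : GradedMod 𝒜 where
  carrier := (ModuleCat.restrictScalars ρ.toRingHom).obj Y
  deg := h.degree Y
  isGraded := ⟨(h.isProjections_degree Y).isInternal, fun _ _ _ _ ha hx => h.smul_mem_degree Y ha hx⟩

lemma isCMAlg_toGraded_iff [IsNoetherianRing R] (Y : ModuleCat.{u} B) :
    isCMAlg R A (h.toGraded Y).carrier ↔ isCMAlg R B Y := by
  have hf : ∀ (r : R) (y : Y), ρ (algebraMap R A r) • y = algebraMap R B r • y := fun r y => by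
    rw [AlgHom.commutes]
  let f : ((ModuleCat.restrictScalars (algebraMap R A)).obj (h.toGraded Y).carrier) ≃ₗ[R]
      (ModuleCat.restrictScalars (algebraMap R B)).obj Y :=
    { AddEquiv.refl Y with
      map_smul' := hf }
  exact isCM_congr f

/-- The functor from `B`-modules to graded `A`-modules. -/
noncomputable def functor [IsNoetherianRing R] : CMCat R B ⥤ GradedCMCat R 𝒜 where
  obj Y := ⟨h.toGraded Y.obj, (h.isCMAlg_toGraded_iff Y.obj).2 Y.property⟩
  map {Y Y'} f := ObjectProperty.homMk (P := fun X : GradedMod 𝒜 => isCMAlg R A X.carrier)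
    (X := ⟨h.toGraded Y.obj, (h.isCMAlg_toGraded_iff Y.obj).2 Y.property⟩)
    (Y := ⟨h.toGraded Y'.obj, (h.isCMAlg_toGraded_iff Y'.obj).2 Y'.property⟩)
    ({ toHom := (ModuleCat.restrictScalars ρ.toRingHom).map f.hom
       map_mem := fun i x hx =>
        (f.hom.hom.map_smul (e (-i)) x).symm.trans
          (congrArg f.hom.hom (h.mem_degree.1 hx)) } : GradedMod.Hom _ _)

lemma sum_mul_mul (b : B) : ∑ i, ∑ j, e i * b * e j = b := by
  simp only [← Finset.mul_sum, h.sum_eq, mul_one, ← Finset.sum_mul, one_mul]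

/-- Preserving degrees means commuting with the idempotents, and each Peirce component e_i b e_j has
the form e_i ρ(a). This is what makes `functor` full. -/
lemma map_smul_of_graded {Y Y' : Type u} [AddCommGroup Y] [Module B Y] [AddCommGroup Y']
    [Module B Y'] (f : Y →+ Y') (hA : ∀ (a : A) y, f (ρ a • y) = ρ a • f y)
    (hdeg : ∀ i, ∀ y ∈ h.degree Y i, f y ∈ h.degree Y' i) (b : B) (y : Y) :
    f (b • y) = b • f y := by
  have he : ∀ i y, f (e i • y) = e i • f y := by
    intro i y
    have h1 : ∀ i y, e i • f (e i • y) = f (e i • y) := fun i y => by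
      have h2 : e i • y ∈ h.degree Y (-i) := by
        rw [h.mem_degree, neg_neg, ← mul_smul, h.mul_self]
      have := h.mem_degree.1 (hdeg _ _ h2)
      rwa [neg_neg] at this
    have h3 : f y = ∑ k, f (e k • y) := by
      rw [← map_sum, ← Finset.sum_smul, h.sum_eq, one_smul]
    rw [h3, Finset.smul_sum, Finset.sum_eq_single i, h1]
    · intro k _ hk
      rw [← h1 k, ← mul_smul, h.mul_of_ne _ _ hk.symm, zero_smul]
    · simp
  rw [← h.sum_mul_mul b, Finset.sum_smul, map_sum, Finset.sum_smul]
  refine Finset.sum_congr rfl fun i _ => ?_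
  rw [Finset.sum_smul, map_sum, Finset.sum_smul]
  refine Finset.sum_congr rfl fun j _ => ?_
  obtain ⟨a, -, ha⟩ := h.exists_mem i j b
  rw [← ha, mul_smul, mul_smul, he, hA]

end Functor

/-! ### From graded modules back to modules over the smash product -/

section Action

lemma eq_of_mul_eq {i g : ι} {a a' : A} (ha : a ∈ 𝒜 g) (ha' : a' ∈ 𝒜 g)
    (haa' : e i * ρ a = e i * ρ a') : a = a' :=
  sub_eq_zero.1 (h.eq_zero (sub_mem ha ha') (by rw [map_sub, mul_sub, haa', sub_self]))

/-- The element of `A` corresponding to the Peirce component `e_i b e_j`. -/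
noncomputable def coeff (i j : ι) (b : B) : A := (h.exists_mem i j b).choose

lemma coeff_mem (i j : ι) (b : B) : h.coeff i j b ∈ 𝒜 (j - i) := (h.exists_mem i j b).choose_spec.1

lemma mul_coeff (i j : ι) (b : B) : e i * ρ (h.coeff i j b) = e i * b * e j :=
  (h.exists_mem i j b).choose_spec.2

lemma coeff_eq {i j : ι} {b : B} {a : A} (ha : a ∈ 𝒜 (j - i)) (hab : e i * ρ a = e i * b * e j) :
    h.coeff i j b = a :=
  h.eq_of_mul_eq (h.coeff_mem i j b) ha ((h.mul_coeff i j b).trans hab.symm)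

lemma coeff_add (i j : ι) (b c : B) : h.coeff i j (b + c) = h.coeff i j b + h.coeff i j c :=
  h.coeff_eq (add_mem (h.coeff_mem i j b) (h.coeff_mem i j c)) (by
    rw [map_add, mul_add, mul_coeff, mul_coeff]; noncomm_ring)

/-- Peirce components multiply like matrix entries: insert 1 = ∑ e_j between b and c. -/
lemma coeff_mul (i k : ι) (b c : B) :
    h.coeff i k (b * c) = ∑ j, h.coeff i j b * h.coeff j k c := by
  refine h.coeff_eq (sum_mem fun j _ => ?_) ?_
  · have := h.mul_mem (h.coeff_mem i j b) (h.coeff_mem j k c)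
    rwa [sub_add_sub_cancel'] at this
  · rw [map_sum, Finset.mul_sum]
    have : ∀ j, e i * ρ (h.coeff i j b * h.coeff j k c) = e i * b * e j * (c * e k) := fun j => by
      rw [map_mul, ← mul_assoc, h.mul_coeff, mul_assoc (e i * b), h.mul_coeff]
      simp only [mul_assoc]
    rw [Finset.sum_congr rfl fun j _ => this j, ← Finset.sum_mul, ← Finset.mul_sum, h.sum_eq]
    simp only [mul_assoc, one_mul]

lemma coeff_e (i j k : ι) : h.coeff i j (e k) = if i = k ∧ j = k then 1 else 0 := by
  split_ifs with hk
  · obtain ⟨rfl, rfl⟩ := hk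
    refine h.coeff_eq (by rw [sub_self]; exact h.one_mem) ?_
    rw [map_one, mul_one, h.mul_self, h.mul_self]
  · refine h.coeff_eq (zero_mem _) ?_
    rw [map_zero, mul_zero]
    by_cases hi : i = k
    · subst hi
      rw [h.mul_self, h.mul_of_ne _ _ fun hj => hk ⟨rfl, hj.symm⟩]
    · rw [h.mul_of_ne _ _ hi, zero_mul]

lemma coeff_map_of_mem {g : ι} {a : A} (ha : a ∈ 𝒜 g) (i j : ι) :
    h.coeff i j (ρ a) = if j - i = g then a else 0 := by
  have hmul : e i * ρ a * e j = if j - i = g then e i * ρ a else 0 := by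
    rw [h.e_mul ha, mul_assoc]
    split_ifs with hg
    · rw [← hg, add_sub_cancel, h.mul_self]
    · rw [h.mul_of_ne _ _ fun h' => hg (by rw [← h', add_sub_cancel_left]), mul_zero]
  split_ifs with hg
  · exact h.coeff_eq (hg ▸ ha) (by rw [hmul, if_pos hg])
  · exact h.coeff_eq (zero_mem _) (by rw [hmul, if_neg hg, map_zero, mul_zero])

variable {Y : Type u} [AddCommGroup Y] [Module A Y] {𝒴 : ι → AddSubgroup Y} {p : ι → Y →+ Y}

/-- The action of `B` on a graded `A`-module. -/
noncomputable def act (p : ι → Y →+ Y) (b : B) (y : Y) : Y :=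
  -- The projection p_{-j} plays the role of e_j; the coefficient, of degree j - i, then moves
  -- degree -j to degree -i.
  ∑ i, ∑ j, h.coeff i j b • p (-j) y

variable (hY : IsGradedModule 𝒜 𝒴) (hp : IsProjections 𝒴 p)

include hY hp

lemma proj_act (b : B) (y : Y) (i : ι) : p (-i) (h.act p b y) = ∑ j, h.coeff i j b • p (-j) y := by
  rw [act, map_sum, Finset.sum_eq_single i]
  · rw [map_sum]
    refine Finset.sum_congr rfl fun j _ => hp.eq_self _ _ ?_
    have := hY.smul_mem _ _ _ _ (h.coeff_mem i j b) (hp.mem (-j) y)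
    rwa [show j - i + -j = -i by abel] at this
  · intro k _ hk
    rw [map_sum]
    refine Finset.sum_eq_zero fun j _ => hp.eq_zero (-k) _ (fun h' => hk (neg_injective h')) _ ?_
    have := hY.smul_mem _ _ _ _ (h.coeff_mem k j b) (hp.mem (-j) y)
    rwa [show j - k + -j = -k by abel] at this
  · simp

lemma act_e (k : ι) (y : Y) : h.act p (e k) y = p (-k) y := by
  rw [act, Finset.sum_eq_single k, Finset.sum_eq_single k]
  · rw [h.coeff_e, if_pos ⟨rfl, rfl⟩, one_smul]
  · intro j _ hj
    rw [h.coeff_e, if_neg fun h' => hj h'.2, zero_smul]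
  · simp
  · intro i _ hi
    refine Finset.sum_eq_zero fun j _ => ?_
    rw [h.coeff_e, if_neg fun h' => hi h'.1, zero_smul]
  · simp

lemma act_add (b c : B) (y : Y) : h.act p (b + c) y = h.act p b y + h.act p c y := by
  simp only [act, h.coeff_add, add_smul, Finset.sum_add_distrib]

/-- The `B`-module structure on a graded `A`-module. -/
noncomputable abbrev module : Module B Y where
  smul := h.act p
  mul_smul b c y := by
    change h.act p (b * c) y = h.act p b (h.act p c y)
    conv_rhs => rw [act]
    rw [act]
    refine Finset.sum_congr rfl fun i _ => ?_
    simp only [h.proj_act hY hp, h.coeff_mul, Finset.sum_smul, Finset.smul_sum, mul_smul]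
    exact Finset.sum_comm
  one_smul y := by
    change h.act p 1 y = y
    have : ∀ s : Finset ι, h.act p (∑ i ∈ s, e i) y = ∑ i ∈ s, h.act p (e i) y := fun s => by
      induction s using Finset.induction_on with
      | empty =>
        rw [Finset.sum_empty, Finset.sum_empty]
        have := h.act_add hY hp 0 0 y
        rwa [add_zero, left_eq_add] at this
      | insert i s hi ih => rw [Finset.sum_insert hi, Finset.sum_insert hi, h.act_add hY hp, ih]
    rw [← h.sum_eq, this]
    simp only [h.act_e hY hp]
    rw [sum_comp_neg fun i => p i y, hp.sum_eq]
  smul_zero b := by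
    change h.act p b 0 = 0
    simp [act]
  zero_smul y := by
    change h.act p 0 y = 0
    have := h.act_add hY hp 0 0 y
    rwa [add_zero, left_eq_add] at this
  smul_add b x y := by
    change h.act p b (x + y) = h.act p b x + h.act p b y
    simp [act, Finset.sum_add_distrib]
  add_smul b c y := h.act_add hY hp b c y

lemma act_map (a : A) (y : Y) : h.act p (ρ a) y = a • y := by
  let := h.module hY hp
  have key : ∀ g, ∀ a ∈ 𝒜 g, h.act p (ρ a) y = a • y := by
    intro g a ha
    rw [act, Finset.sum_comm]
    have : ∀ j, ∑ i, h.coeff i j (ρ a) • p (-j) y = a • p (-j) y := fun j => by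
      rw [Finset.sum_eq_single (j - g), h.coeff_map_of_mem ha, if_pos (by abel)]
      · intro i _ hi
        rw [h.coeff_map_of_mem ha, if_neg fun h' => hi (by rw [← h']; abel), zero_smul]
      · simp
    rw [Finset.sum_congr rfl fun j _ => this j, ← Finset.smul_sum,
      sum_comp_neg fun i => p i y, hp.sum_eq]
  obtain ⟨c, hc, rfl⟩ := h.exists_sum a
  change ρ (∑ g, c g) • y = _
  rw [map_sum, Finset.sum_smul, Finset.sum_smul]
  exact Finset.sum_congr rfl fun g _ => key g _ (hc g)

end Action

section Equivalence

variable [IsNoetherianRing R]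

instance : h.functor.Faithful where
  map_injective {Y Y'} f g hfg := by
    ext y
    have h1 := congrArg (fun f => f.hom.toHom) hfg
    exact congrArg (fun f => f.hom y) h1

instance : h.functor.Full where
  map_surjective {Y Y'} f := by
    let t : Y.obj →+ Y'.obj := f.hom.toHom.hom.toAddMonoidHom
    have ht := h.map_smul_of_graded t (fun a y => f.hom.toHom.hom.map_smul a y)
      fun i y hy => f.hom.map_mem i y hy
    refine ⟨ObjectProperty.homMk (ModuleCat.ofHom { t with map_smul' := ht }), ?_⟩
    rfl

/-- The smash product acts on the same abelian group, with e_{-i} acting as the i-th projection, so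
the identity map is the required isomorphism. -/
instance : h.functor.EssSurj where
  mem_essImage X := by
    obtain ⟨p, hp⟩ := exists_isProjections X.obj.isGraded.isInternal
    let := h.module X.obj.isGraded hp
    let Y : ModuleCat.{u} B := ModuleCat.of B X.obj.carrier
    let g : (h.toGraded Y).carrier ≃ₗ[A] X.obj.carrier :=
      { AddEquiv.refl X.obj.carrier with
        map_smul' := fun a y => h.act_map X.obj.isGraded hp a y }
    let f : (h.toGraded Y).carrier ≅ X.obj.carrier := g.toModuleIso
    have hdeg : ∀ i (x : X.obj.carrier), x ∈ h.degree X.obj.carrier i ↔ x ∈ X.obj.deg i := by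
      intro i x
      have h1 : e (-i) • x = p i x := by
        have := h.act_e X.obj.isGraded hp (-i) x
        rwa [neg_neg] at this
      rw [h.mem_degree, h1]
      exact ⟨fun h2 => h2 ▸ hp.mem i x, hp.eq_self i x⟩
    let F : h.toGraded Y ≅ X.obj :=
      { hom := ({ toHom := f.hom, map_mem := fun i x hx => (hdeg i x).1 hx } : GradedMod.Hom _ _)
        inv := ({ toHom := f.inv, map_mem := fun i x hx => (hdeg i x).2 hx } : GradedMod.Hom _ _)
        hom_inv_id := GradedMod.Hom.ext f.hom_inv_id
        inv_hom_id := GradedMod.Hom.ext f.inv_hom_id }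
    have hCM : isCMAlg R B Y := by
      rw [← h.isCMAlg_toGraded_iff]
      exact X.property.of_linearEquiv
        (((ModuleCat.restrictScalars (algebraMap R A)).mapIso f).toLinearEquiv)
    exact ⟨⟨Y, hCM⟩, ⟨ObjectProperty.isoMk _ F⟩⟩

lemma nonempty_equivalence : Nonempty (GradedCMCat R 𝒜 ≌ CMCat R B) :=
  have : h.functor.IsEquivalence := {}
  ⟨h.functor.asEquivalence.symm⟩

end Equivalence

end IsSmashProduct

end Smash

/-! ### Reflexive modules and Cohen-Macaulay modules over an endomorphism ring -/

section Morita

variable {R : Type u} [CommRing R]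

/-- `Hom_R(N, X)` as a left module over `End_R(N)`. -/
def HomModule (R N X : Type u) [CommRing R] [AddCommGroup N] [Module R N] [AddCommGroup X]
    [Module R X] : Type u := N →ₗ[R] X

variable {N X X' Y : Type u} [AddCommGroup N] [Module R N] [AddCommGroup X] [Module R X]
  [AddCommGroup X'] [Module R X'] [AddCommGroup Y] [Module R Y] [Module (EndRing R N) Y]
  [IsScalarTower R (EndRing R N) Y]

instance : AddCommGroup (HomModule R N X) := inferInstanceAs (AddCommGroup (N →ₗ[R] X))

instance : Module (EndRing R N) (HomModule R N X) where
  smul b f := LinearMap.comp (f : N →ₗ[R] X) b.unop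
  one_smul f := LinearMap.comp_id (f : N →ₗ[R] X)
  mul_smul _ _ _ := rfl
  smul_zero _ := LinearMap.zero_comp _
  smul_add _ _ _ := LinearMap.add_comp _ _ _
  add_smul _ _ _ := LinearMap.comp_add _ _ _
  zero_smul _ := LinearMap.comp_zero _

/-- Composition with a linear map, as a homomorphism of `End_R(N)`-modules. -/
def HomModule.map (g : X →ₗ[R] X') : HomModule R N X →ₗ[EndRing R N] HomModule R N X' where
  toFun f := g ∘ₗ (f : N →ₗ[R] X)
  map_add' f f' := LinearMap.comp_add (f : N →ₗ[R] X) (f' : N →ₗ[R] X) g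
  map_smul' _ _ := rfl

variable [IsDomain R]

lemma IsWModule.submodule (hX : IsWModule R X) (P : Submodule R X)
    (hP : ∀ a : R, a ≠ 0 → ∀ x, a • x ∈ P → x ∈ P) : IsWModule R P where
  isTorsionFree := by
    have := hX.isTorsionFree
    infer_instance
  exists_eq_smul hJ a ha y H := by
    obtain ⟨z, hz⟩ := hX.exists_eq_smul hJ ha (y := y) fun r hr => by
      obtain ⟨z, hz⟩ := H r hr
      exact ⟨z, congrArg Subtype.val hz⟩
    exact ⟨⟨z, hP a ha z (hz ▸ y.2)⟩, Subtype.ext hz⟩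

/-- The map g must satisfy h(n) g(x) = φ(h ⊗ x)(n) for every functional h on N and n ∈ N, where h ⊗
x denotes m ↦ h(m) x. So y(x) = φ(h₀ ⊗ x)(n₀) has to be h₀(n₀) g(x). Equivariance under the rank-one
endomorphism m ↦ h(m) n₀ gives h(n) y(x) = h₀(n₀) φ(h ⊗ x)(n), so y is divisible by h₀(n₀), as
tested on the trace ideal. -/
lemma exists_linearMap_of_equivariant [IsNoetherianRing R] [IsIntegrallyClosed R]
    [Module.Finite R N] (hX' : IsWModule R X') {h₀ : N →ₗ[R] R} {n₀ : N} (h0 : h₀ n₀ ≠ 0)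
    (φ : (N →ₗ[R] X) →+ (N →ₗ[R] X'))
    (hφ : ∀ (b : N →ₗ[R] N) (f : N →ₗ[R] X), φ (f ∘ₗ b) = φ f ∘ₗ b) :
    ∃ g : X →ₗ[R] X', ∀ f, φ f = g ∘ₗ f := by
  have := hX'.isTorsionFree
  have hsmul : ∀ (r : R) (f : N →ₗ[R] X), φ (r • f) = r • φ f := fun r f => by
    have := hφ (r • LinearMap.id) f
    rwa [LinearMap.comp_smul, LinearMap.comp_smul, LinearMap.comp_id, LinearMap.comp_id] at this
  have hGV : IsGV (traceIdeal R N) := isGV_traceIdeal (f := h₀) (by rintro rfl; exact h0 rfl)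
  let y : X →ₗ[R] X' :=
    { toFun := fun x => φ (h₀.smulRight x) n₀
      map_add' := fun x x' => by
        rw [show h₀.smulRight (x + x') = h₀.smulRight x + h₀.smulRight x' by ext; simp, map_add,
          LinearMap.add_apply]
      map_smul' := fun r x => by
        rw [show h₀.smulRight (r • x) = r • h₀.smulRight x by
          ext; exact smul_comm _ _ _, hsmul,
          LinearMap.smul_apply, RingHom.id_apply] }
  have hy : ∀ x (h : N →ₗ[R] R) n, h n • y x = h₀ n₀ • φ (h.smulRight x) n := by
    intro x h n
    have h1 := hφ (h.smulRight n₀) (h₀.smulRight x)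
    have h2 : h₀.smulRight x ∘ₗ h.smulRight n₀ = h₀ n₀ • h.smulRight x := by
      ext m
      change h₀ (h m • n₀) • x = h₀ n₀ • h m • x
      rw [map_smul, smul_eq_mul, mul_comm, mul_smul]
    rw [h2, hsmul] at h1
    change h n • φ (h₀.smulRight x) n₀ = _
    have h2 := LinearMap.congr_fun h1 n
    simpa using h2.symm
  obtain ⟨g, hg⟩ := exists_linearMap_eq_smul h0 y fun x => hX'.exists_eq_smul hGV h0 fun r hr => by
    induction hr using Submodule.span_induction with
    | zero => exact ⟨0, by simp⟩
    | add r s _ _ hr hs =>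
      obtain ⟨z, hz⟩ := hr
      obtain ⟨w, hw⟩ := hs
      exact ⟨z + w, by rw [add_smul, hz, hw, smul_add]⟩
    | smul c r _ hr =>
      obtain ⟨z, hz⟩ := hr
      exact ⟨c • z, by rw [smul_assoc, hz, smul_comm]⟩
    | mem r hr =>
      obtain ⟨h, n, rfl⟩ := hr
      exact ⟨_, hy x h n⟩
  refine ⟨g, fun f => ?_⟩
  ext n
  apply smul_right_injective X' h0
  change h₀ n₀ • φ f n = h₀ n₀ • g (f n)
  rw [← LinearMap.smul_apply _ g, ← hg]
  change _ = φ (h₀.smulRight (f n)) n₀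
  rw [show h₀.smulRight (f n) = f ∘ₗ h₀.smulRight n by ext; simp, hφ]
  simp

variable (R N Y) in
/-- The `End_R(N)`-equivariant maps from `Hom_R(N, R)` to `Y`. -/
def equivariantMaps : Submodule R (Module.Dual R N →ₗ[R] Y) where
  carrier := {φ | ∀ (b : N →ₗ[R] N) (h : Module.Dual R N),
    φ (h ∘ₗ b) = (MulOpposite.op b : EndRing R N) • φ h}
  zero_mem' b h := (smul_zero _).symm
  add_mem' {φ ψ} hφ hψ b h := by
    rw [LinearMap.add_apply, LinearMap.add_apply, hφ, hψ, smul_add]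
  smul_mem' r φ hφ b h := by
    have := IsScalarTower.to_smulCommClass (R := R) (A := EndRing R N) (M := Y)
    rw [LinearMap.smul_apply, LinearMap.smul_apply, hφ, smul_comm]

lemma mem_equivariantMaps {φ : Module.Dual R N →ₗ[R] Y} : φ ∈ equivariantMaps R N Y ↔
    ∀ (b : N →ₗ[R] N) (h : Module.Dual R N),
      φ (h ∘ₗ b) = (MulOpposite.op b : EndRing R N) • φ h := Iff.rfl

/-- If a φ is equivariant with a ≠ 0, so is φ, since Y is torsion-free; the rest is inherited from
the full module of linear maps. -/
lemma isWModule_equivariantMaps (hY : IsWModule R Y) : IsWModule R (equivariantMaps R N Y) := by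
  refine (hY.linearMap R _).submodule _ fun a ha φ hφ b h => ?_
  have := hY.isTorsionFree
  have := IsScalarTower.to_smulCommClass (R := R) (A := EndRing R N) (M := Y)
  apply smul_right_injective Y ha
  change a • _ = a • _
  rw [← LinearMap.smul_apply, hφ, LinearMap.smul_apply, smul_comm]

variable (R N Y) in
/-- The canonical map from `Y` to `Hom_R(N, X)`, where `X` is the module of equivariant maps from
`Hom_R(N, R)` to `Y`. -/
def toHomEquivariantMaps : Y →ₗ[R] N →ₗ[R] equivariantMaps R N Y :=
  LinearMap.mk₂ R (fun y n => ⟨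
    { toFun := fun h => (MulOpposite.op (LinearMap.smulRight h n) : EndRing R N) • y
      map_add' := fun h h' => by
        rw [← add_smul, ← MulOpposite.op_add]
        congr 2; ext; simp [add_smul]
      map_smul' := fun r h => by
        rw [RingHom.id_apply, ← smul_assoc, ← MulOpposite.op_smul]
        congr 2; ext; simp [mul_smul] },
    fun b h => by
      change (MulOpposite.op (LinearMap.smulRight (h ∘ₗ b) n) : EndRing R N) • y =
        (MulOpposite.op b : EndRing R N) •
          (MulOpposite.op (LinearMap.smulRight h n) : EndRing R N) • y
      rw [← mul_smul, ← MulOpposite.op_mul]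
      congr 2⟩)
    (fun y y' n => Subtype.ext (LinearMap.ext fun h => smul_add _ _ _))
    (fun r y n => Subtype.ext (LinearMap.ext fun h => by
      have := IsScalarTower.to_smulCommClass (R := R) (A := EndRing R N) (M := Y)
      exact smul_comm _ _ _))
    (fun y n n' => Subtype.ext (LinearMap.ext fun h => by
      change (MulOpposite.op (LinearMap.smulRight h (n + n')) : EndRing R N) • y =
        (MulOpposite.op (LinearMap.smulRight h n) : EndRing R N) • y +
          (MulOpposite.op (LinearMap.smulRight h n') : EndRing R N) • y
      rw [← add_smul, ← MulOpposite.op_add]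
      congr 2; ext; simp))
    (fun r y n => Subtype.ext (LinearMap.ext fun h => by
      change (MulOpposite.op (LinearMap.smulRight h (r • n)) : EndRing R N) • y =
        r • (MulOpposite.op (LinearMap.smulRight h n) : EndRing R N) • y
      rw [← smul_assoc, ← MulOpposite.op_smul]
      congr 2; ext; exact smul_comm _ _ _))

lemma toHomEquivariantMaps_apply (y : Y) (n : N) (h : Module.Dual R N) :
    (toHomEquivariantMaps R N Y y n : Module.Dual R N →ₗ[R] Y) h =
      (MulOpposite.op (LinearMap.smulRight h n) : EndRing R N) • y := rfl

lemma toHomEquivariantMaps_smul (b : EndRing R N) (y : Y) :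
    toHomEquivariantMaps R N Y (b • y) = toHomEquivariantMaps R N Y y ∘ₗ b.unop := by
  ext n h
  rw [LinearMap.comp_apply, toHomEquivariantMaps_apply, toHomEquivariantMaps_apply, ← mul_smul]
  congr 1
  apply MulOpposite.unop_injective
  ext x
  simp

/-- If r = ∑ h_i ⊗ n_i on N, then r f is the image of ∑ f(n_i)(h_i) ∈ Y, by equivariance of the
values of f. So every free scalar of N multiplies f into the image of Y, and the w-property of Y
removes the scalar. -/
lemma bijective_toHomEquivariantMaps [IsNoetherianRing R] [IsIntegrallyClosed R]
    [Module.Finite R N] [Module.IsTorsionFree R N] (hY : IsWModule R Y) :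
    Function.Bijective (toHomEquivariantMaps R N Y) := by
  have := hY.isTorsionFree
  have hT : IsGV (freeScalars R N) := isGV_freeScalars
  have hsmul : ∀ (r : R) (y : Y),
      (MulOpposite.op (r • LinearMap.id : N →ₗ[R] N) : EndRing R N) • y = r • y := fun r y => by
    have : (MulOpposite.op (r • LinearMap.id : N →ₗ[R] N) : EndRing R N) = r • 1 := rfl
    rw [this, smul_assoc, one_smul]
  obtain ⟨a, haT, ha⟩ := hT.exists_ne_zero
  have hinj : Function.Injective (toHomEquivariantMaps R N Y) := by
    rw [injective_iff_map_eq_zero]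
    intro y hy
    have h1 : ∀ z : Module.Dual R N ⊗[R] N,
        (MulOpposite.op (dualTensorHom R N N z) : EndRing R N) • y = 0 := fun z => by
      induction z with
      | zero => simp
      | add x x' hx hx' => rw [map_add, MulOpposite.op_add, add_smul, hx, hx', add_zero]
      | tmul h n =>
        have h2 := toHomEquivariantMaps_apply y n h
        rw [hy] at h2
        rw [show dualTensorHom R N N (h ⊗ₜ n) = LinearMap.smulRight h n by ext; simp]
        exact h2.symm
    obtain ⟨z, hz⟩ := haT
    have h2 := h1 z
    rw [hz] at h2
    change (MulOpposite.op (a • LinearMap.id : N →ₗ[R] N) : EndRing R N) • y = 0 at h2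
    rw [hsmul] at h2
    simpa [ha] using h2
  refine ⟨hinj, fun f => ?_⟩
  have key : ∀ r ∈ freeScalars R N, ∃ y, toHomEquivariantMaps R N Y y = r • f := by
    rintro r ⟨z, hz⟩
    have h1 : ∀ z : Module.Dual R N ⊗[R] N,
        ∃ y, toHomEquivariantMaps R N Y y = f ∘ₗ dualTensorHom R N N z := fun z => by
      induction z with
      | zero => exact ⟨0, by simp⟩
      | add x x' hx hx' =>
        obtain ⟨y, hy⟩ := hx
        obtain ⟨y', hy'⟩ := hx'
        exact ⟨y + y', by rw [map_add, map_add, hy, hy', LinearMap.comp_add]⟩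
      | tmul h n =>
        refine ⟨(f n : Module.Dual R N →ₗ[R] Y) h, ?_⟩
        ext n' h'
        rw [toHomEquivariantMaps_apply, ← mem_equivariantMaps.1 (f n).2]
        have : h ∘ₗ h'.smulRight n' = h n' • h' := by
          ext; simp [mul_comm]
        rw [this, map_smul]
        simp
    obtain ⟨y, hy⟩ := h1 z
    refine ⟨y, ?_⟩
    rw [hy, hz]
    change f ∘ₗ (r • LinearMap.id) = _
    rw [LinearMap.comp_smul, LinearMap.comp_id]
  obtain ⟨y, hy⟩ := key a haT
  obtain ⟨m, hm⟩ := hY.exists_eq_smul hT ha (y := y) fun r hr => by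
    obtain ⟨z, hz⟩ := key r hr
    refine ⟨z, hinj ?_⟩
    rw [map_smul, map_smul, hy, hz, smul_comm]
  refine ⟨m, ?_⟩
  have hE := ((isWModule_equivariantMaps (R := R) (N := N) hY).linearMap R N).isTorsionFree
  apply smul_right_injective _ ha
  change a • _ = a • f
  rw [← map_smul, ← hm, hy]

variable (R N)

lemma isCMAlg_homModule_iff [IsNoetherianRing R] (X : Type u) [AddCommGroup X] [Module R X] :
    isCMAlg R (EndRing R N) (ModuleCat.of _ (HomModule R N X)) ↔ IsCM R (N →ₗ[R] X) := by
  have hf : ∀ (r : R) (f : N →ₗ[R] X),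
      f ∘ₗ (algebraMap R (EndRing R N) r).unop = r • f := fun r f => by
    ext n
    exact map_smul f r n
  let f : (ModuleCat.restrictScalars (algebraMap R (EndRing R N))).obj
      (ModuleCat.of _ (HomModule R N X)) ≃ₗ[R] (N →ₗ[R] X) :=
    { AddEquiv.refl (N →ₗ[R] X) with map_smul' := hf }
  exact isCM_congr f

/-- The functor `Hom_R(N, -)`. -/
noncomputable def homFunctor [IsNoetherianRing R] : ZCat R N ⥤ CMCat R (EndRing R N) where
  obj X := ⟨ModuleCat.of _ (HomModule R N X.obj), (isCMAlg_homModule_iff R N _).2 X.property.2.2⟩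
  map f := ObjectProperty.homMk (ModuleCat.ofHom (HomModule.map f.hom.hom))

variable [IsNoetherianRing R] [IsIntegrallyClosed R]

lemma nonempty_equivalence_zCat [Module.Finite R N] [Nontrivial N] (hN : IsWModule R N) :
    Nonempty (CMCat R (EndRing R N) ≌ ZCat R N) := by
  have := hN.isTorsionFree
  have hrefl := hN.isReflexive
  obtain ⟨n₀, hn₀⟩ := exists_ne (0 : N)
  obtain ⟨h₀, h0⟩ : ∃ h : N →ₗ[R] R, h n₀ ≠ 0 := by
    by_contra! H
    refine hn₀ ((Module.bijective_dual_eval R N).1 ?_)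
    rw [map_zero]
    exact LinearMap.ext H
  have hfaithful : (homFunctor R N).Faithful :=
    { map_injective := fun {X X'} f g hfg => by
        have hr := X'.property.2.1
        have := (IsWModule.of_isReflexive (R := R) (M := X'.obj)).isTorsionFree
        ext x
        have h1 := congrArg (fun t => t.hom.hom (h₀.smulRight x : N →ₗ[R] X.obj)) hfg
        have h2 := LinearMap.congr_fun h1 n₀
        change f.hom.hom (h₀ n₀ • x) = g.hom.hom (h₀ n₀ • x) at h2
        rw [map_smul, map_smul] at h2
        exact smul_right_injective _ h0 h2 }
  have hfull : (homFunctor R N).Full :=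
    { map_surjective := fun {X X'} φ => by
        have hr := X'.property.2.1
        obtain ⟨g, hg⟩ := exists_linearMap_of_equivariant (R := R) (N := N) (X := X.obj)
          (X' := X'.obj) IsWModule.of_isReflexive h0 φ.hom.hom.toAddMonoidHom
          fun b f => φ.hom.hom.map_smul (MulOpposite.op b) f
        refine ⟨ObjectProperty.homMk (ModuleCat.ofHom g), ?_⟩
        ext f
        exact (hg f).symm }
  have hess : (homFunctor R N).EssSurj :=
    { mem_essImage := fun Y => by
        let := Module.compHom Y.obj (algebraMap R (EndRing R N))
        have : IsScalarTower R (EndRing R N) Y.obj := ⟨fun r b y => by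
          change (r • b) • y = algebraMap R (EndRing R N) r • (b • y)
          rw [Algebra.smul_def, mul_smul]⟩
        have hCM : IsCM R Y.obj := Y.property
        have := hCM.finite
        have hW := hCM.isWModule
        have hb := bijective_toHomEquivariantMaps (R := R) (N := N) hW
        let f : Y.obj ≃ₗ[R] (N →ₗ[R] equivariantMaps R N Y.obj) := LinearEquiv.ofBijective _ hb
        let g : Y.obj ≃ₗ[EndRing R N] HomModule R N (equivariantMaps R N Y.obj) :=
          { f.toAddEquiv with
            map_smul' := fun b y => toHomEquivariantMaps_smul b y }
        -- A submodule of Hom_R between finitely generated modules, over a noetherian ring.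
        have hfin : Module.Finite R (equivariantMaps R N Y.obj) := inferInstance
        exact ⟨⟨ModuleCat.of R (equivariantMaps R N Y.obj), hfin,
          (isWModule_equivariantMaps hW).isReflexive, hCM.of_linearEquiv f.symm⟩,
          ⟨ObjectProperty.isoMk _ g.symm.toModuleIso⟩⟩ }
  have : (homFunctor R N).IsEquivalence := {}
  exact ⟨(homFunctor R N).asEquivalence.symm⟩

end Morita

/-! ### Algebras which are strongly graded up to Glaz-Vasconcelos ideals -/

section StronglyGraded

variable {ι : Type} [AddCommGroup ι] [Fintype ι] [DecidableEq ι]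
  {R : Type u} [CommRing R] {S : Type u} [CommRing S] [Algebra R S]

/-- A graded `R`-algebra `S` with `S_0 = R` such that `S_i S_{-i}` is a Glaz-Vasconcelos ideal for
all `i`. -/
structure IsGVStronglyGraded (R : Type u) [CommRing R] {S : Type u} [CommRing S] [Algebra R S]
    (𝒮 : ι → AddSubgroup S) : Prop where
  isInternal : DirectSum.IsInternal 𝒮
  mul_mem : ∀ {i j a b}, a ∈ 𝒮 i → b ∈ 𝒮 j → a * b ∈ 𝒮 (i + j)
  mem_zero_iff : ∀ s, s ∈ 𝒮 0 ↔ ∃ r, algebraMap R S r = s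
  isGV : ∀ i, IsGV (Ideal.span {r : R | ∃ s ∈ 𝒮 i, ∃ t ∈ 𝒮 (-i), algebraMap R S r = s * t})

namespace IsGVStronglyGraded

variable {𝒮 : ι → AddSubgroup S} (hS : IsGVStronglyGraded R 𝒮)

include hS

lemma isGradedModule : IsGradedModule 𝒮 𝒮 :=
  ⟨hS.isInternal, fun _ _ _ _ ha hx => hS.mul_mem ha hx⟩

lemma one_mem : (1 : S) ∈ 𝒮 0 := (hS.mem_zero_iff 1).2 ⟨1, map_one _⟩

lemma exists_mul_eq (i : ι) :
    ∃ s ∈ 𝒮 i, ∃ t ∈ 𝒮 (-i), ∃ r : R, r ≠ 0 ∧ algebraMap R S r = s * t := by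
  by_contra! H
  refine (hS.isGV i).1 (Ideal.span_eq_bot.2 ?_)
  rintro r ⟨s, hs, t, ht, hr⟩
  by_contra hr0
  exact H s hs t ht r hr0 hr

lemma exists_algebraMap_eq_mul {i : ι} {s t : S} (hs : s ∈ 𝒮 i) (ht : t ∈ 𝒮 (-i)) :
    ∃ r, algebraMap R S r = s * t :=
  (hS.mem_zero_iff _).1 (by have := hS.mul_mem hs ht; rwa [add_neg_cancel] at this)

variable {N : Type u} [AddCommGroup N] [Module R N] [Module S N] [IsScalarTower R S N]
  {𝒩 : ι → AddSubgroup N}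

section Projections

variable (hN : IsGradedModule 𝒮 𝒩) {p : ι → N →+ N} (hp : IsProjections 𝒩 p)

include hN hp

lemma proj_smul {m : ι} {c : S} (hc : c ∈ 𝒮 m) (k : ι) (x : N) :
    p (m + k) (c • x) = c • p k x := by
  have h1 : ∀ j, p (m + k) (c • p j x) = if j = k then c • p j x else 0 := fun j => by
    rw [hp.apply_eq_ite _ (hN.smul_mem _ _ _ _ hc (hp.mem j x))]
    simp
  conv_lhs => rw [← hp.sum_eq x, Finset.smul_sum, map_sum, Finset.sum_congr rfl fun j _ => h1 j]
  simp

lemma map_smul_of_homogeneous (f : N →+ N)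
    (hf : ∀ m k, ∀ c ∈ 𝒮 m, ∀ x ∈ 𝒩 k, f (c • x) = c • f x) (c : S) (x : N) :
    f (c • x) = c • f x := by
  obtain ⟨q, hq⟩ := exists_isProjections hS.isInternal
  have h1 : ∀ m, ∀ c ∈ 𝒮 m, f (c • x) = c • f x := fun m c hc => by
    conv_lhs => rw [← hp.sum_eq x, Finset.smul_sum, map_sum]
    conv_rhs => rw [← hp.sum_eq x, map_sum, Finset.smul_sum]
    exact Finset.sum_congr rfl fun k _ => hf m k c hc _ (hp.mem k x)
  rw [← hq.sum_eq c, Finset.sum_smul, map_sum, Finset.sum_smul]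
  exact Finset.sum_congr rfl fun m _ => h1 m _ (hq.mem m c)

lemma proj_smul_base (k : ι) (r : R) (x : N) : p k (r • x) = r • p k x := by
  have := hS.proj_smul hN hp ((hS.mem_zero_iff _).2 ⟨r, rfl⟩) k x
  rwa [zero_add, algebraMap_smul, algebraMap_smul] at this

end Projections

lemma exists_isProjections_linear (hN : IsGradedModule 𝒮 𝒩) :
    ∃ P : ι → N →ₗ[R] N, IsProjections 𝒩 fun i => (P i).toAddMonoidHom := by
  obtain ⟨p, hp⟩ := exists_isProjections hN.isInternal
  exact ⟨fun i => { p i with map_smul' := hS.proj_smul_base hN hp i }, hp⟩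

section Extension

variable [IsDomain R] (hN : IsGradedModule 𝒮 𝒩) (hW : IsWModule R N) {P : ι → N →ₗ[R] N}
  (hP : IsProjections 𝒩 fun i => (P i).toAddMonoidHom)

include hN hW hP

omit hN hP in
-- Some s ∈ S_i has a multiple st that is a nonzero scalar of R, and N is torsion-free.
lemma eq_zero_of_smul_eq_zero {i : ι} {x : N} (h : ∀ s ∈ 𝒮 i, s • x = 0) : x = 0 := by
  have := hW.isTorsionFree
  obtain ⟨s, hs, t, -, r, hr, hrst⟩ := hS.exists_mul_eq i
  have : r • x = 0 := by
    rw [← algebraMap_smul S, hrst, mul_comm, mul_smul, h s hs, smul_zero]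
  simpa [hr] using this

/-- Formally g(x) = s⁻¹ h(s x_k), where s ∈ S_{i-k} moves x_k into N_i. With s₀ t₀ = a, the element
t₀ h(s₀ x_k) is a times the desired value; division by a is tested on the GV ideal generated by
S_{i-k} S_{k-i}. -/
lemma exists_linearMap_homogeneous (i k : ι) (h : N →ₗ[R] N) :
    ∃ g : N →ₗ[R] N, ∀ x, ∀ s ∈ 𝒮 (i - k), s • g x = h (s • P k x) := by
  have := hW.isTorsionFree
  obtain ⟨s₀, hs₀, t₀, ht₀, a, ha, hast⟩ := hS.exists_mul_eq (i - k)
  let y : N →ₗ[R] N :=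
    Algebra.lsmul R R N t₀ ∘ₗ h ∘ₗ Algebra.lsmul R R N s₀ ∘ₗ P k
  have hy : ∀ x, y x = t₀ • h (s₀ • P k x) := fun x => rfl
  have key : ∀ x, ∀ s ∈ 𝒮 (i - k), s • y x = a • h (s • P k x) := by
    intro x s hs
    obtain ⟨r, hr⟩ := hS.exists_algebraMap_eq_mul hs ht₀
    have h1 : r • s₀ • P k x = a • s • P k x := by
      rw [← algebraMap_smul S r, ← algebraMap_smul S a, hr, hast, smul_smul, smul_smul]
      congr 1
      ring
    rw [hy, ← mul_smul, ← hr, algebraMap_smul, ← map_smul h, h1, map_smul h]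
  obtain ⟨g, hg⟩ := exists_linearMap_eq_smul ha y fun x => by
    refine hW.exists_eq_smul (hS.isGV (i - k)) ha fun r hr => ?_
    induction hr using Submodule.span_induction with
    | zero => exact ⟨0, by simp⟩
    | add r s _ _ hr hs =>
      obtain ⟨z, hz⟩ := hr
      obtain ⟨w, hw⟩ := hs
      exact ⟨z + w, by rw [add_smul, hz, hw, smul_add]⟩
    | smul c r _ hr =>
      obtain ⟨z, hz⟩ := hr
      exact ⟨c • z, by rw [smul_assoc, hz, smul_comm]⟩
    | mem r hr =>
      obtain ⟨s, hs, t, ht, hr⟩ := hr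
      refine ⟨t • h (s • P k x), ?_⟩
      rw [← algebraMap_smul S r, hr, mul_comm, mul_smul, key x s hs, smul_comm]
  refine ⟨g, fun x s hs => ?_⟩
  apply smul_right_injective N ha
  change a • _ = a • _
  rw [← key x s hs, hg, LinearMap.smul_apply, smul_comm]

/-- Every `R`-linear map `N_i → N_j` extends to an `S`-linear endomorphism of `N` of degree
`j - i`. -/
lemma exists_extension (i j : ι) (b : N →ₗ[R] N) :
    ∃ f : N →ₗ[S] N, (∀ k, ∀ x ∈ 𝒩 k, f x ∈ 𝒩 (k + (j - i))) ∧
      ∀ x, f (P i x) = P j (b (P i x)) := by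
  have := hW.isTorsionFree
  set h : N →ₗ[R] N := P j ∘ₗ b
  -- Each `g k` is the prospective extension on N_k and vanishes on the other components, so the
  -- extension is their sum.
  choose g hg using fun k => hS.exists_linearMap_homogeneous hN hW hP i k h
  have hgk : ∀ k l, k ≠ l → ∀ x ∈ 𝒩 k, g l x = 0 := fun k l hkl x hx =>
    hS.eq_zero_of_smul_eq_zero hW (i := i - l) fun s hs => by
      have h0 : P l x = 0 := hP.eq_zero k l hkl x hx
      rw [hg l x s hs, h0, smul_zero, map_zero]
  have hsum : ∀ k, ∀ x ∈ 𝒩 k, (∑ l, g l) x = g k x := fun k x hx => by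
    rw [LinearMap.sum_apply, Finset.sum_eq_single k]
    · exact fun l _ hl => hgk k l hl.symm x hx
    · simp
  have hself : ∀ k, ∀ x ∈ 𝒩 k, P k x = x := hP.eq_self
  have hlin := hS.map_smul_of_homogeneous hN hP (∑ l, g l : N →ₗ[R] N).toAddMonoidHom
    fun m k c hc x hx => by
      have hcx := hN.smul_mem _ _ _ _ hc hx
      change (∑ l, g l) (c • x) = c • (∑ l, g l) x
      rw [hsum _ _ hcx, hsum _ _ hx, ← sub_eq_zero]
      refine hS.eq_zero_of_smul_eq_zero hW (i := i - (m + k)) fun s hs => ?_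
      have hsc : s * c ∈ 𝒮 (i - k) := by
        have := hS.mul_mem hs hc
        rwa [show i - (m + k) + m = i - k by abel] at this
      rw [smul_sub, hg _ _ _ hs, hself _ _ hcx, smul_smul, smul_smul, hg _ _ _ hsc, hself _ _ hx,
        sub_self]
  refine ⟨{ (∑ l, g l : N →ₗ[R] N) with map_smul' := hlin }, fun k x hx => ?_, fun x => ?_⟩
  · change (∑ l, g l) x ∈ _
    rw [hsum k x hx]
    -- The degree of g_k(x) is visible only after multiplication by s; then a g_k(x) = t s g_k(x)
    -- has the right degree, and torsion-freeness removes a.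
    obtain ⟨s, hs, t, ht, a, ha, hast⟩ := hS.exists_mul_eq (i - k)
    have h1 : s • g k x ∈ 𝒩 j := by
      rw [hg k x s hs]
      exact hP.mem j _
    have h2 : a • g k x ∈ 𝒩 (k + (j - i)) := by
      rw [← algebraMap_smul S, hast, mul_comm, mul_smul]
      have := hN.smul_mem _ _ _ _ ht h1
      rwa [show -(i - k) + j = k + (j - i) by abel] at this
    have h3 := hself _ _ h2
    rw [map_smul] at h3
    rw [← smul_right_injective N ha h3]
    exact hP.mem _ _
  · change (∑ l, g l) (P i x) = _
    have hx : P i x ∈ 𝒩 i := hP.mem i x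
    rw [hsum i _ hx]
    have := hg i (P i x) 1 (by rw [sub_self]; exact hS.one_mem)
    rwa [one_smul, one_smul, hself _ _ hx] at this

end Extension

/-! ### Endomorphism rings over R as smash products -/

section SmashProduct

variable [IsDomain R]

/-- The inclusion `End_S(N) → End_R(N)`. -/
def restrictEnd (R S N : Type u) [CommRing R] [CommRing S] [Algebra R S] [AddCommGroup N]
    [Module R N] [Module S N] [IsScalarTower R S N] : EndRing S N →ₐ[R] EndRing R N where
  toFun f := MulOpposite.op (f.unop.restrictScalars R)
  map_one' := rfl
  map_mul' _ _ := rfl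
  map_zero' := rfl
  map_add' _ _ := rfl
  commutes' _ := rfl

/-- With e_i the projection onto N_i and products read from left to right, e_i b e_j is the
component N_i → N_j of b. Existence of the corresponding element of degree j - i is
`exists_extension`. Uniqueness holds because a homogeneous S-linear map killing N_i kills each N_k,
as S_{i-k} moves N_k into N_i. -/
lemma isSmashProduct_end (hN : IsGradedModule 𝒮 𝒩) (hW : IsWModule R N) :
    ∃ e, IsSmashProduct (endGrading S 𝒩) (restrictEnd R S N) e := by
  obtain ⟨P, hP⟩ := hS.exists_isProjections_linear hN
  have hmem : ∀ i x, P i x ∈ 𝒩 i := hP.mem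
  have hself : ∀ k, ∀ x ∈ 𝒩 k, P k x = x := hP.eq_self
  have hzero : ∀ k l, k ≠ l → ∀ x ∈ 𝒩 k, P l x = 0 := hP.eq_zero
  have hsum : ∀ x, ∑ i, P i x = x := hP.sum_eq
  have hcomm : ∀ (f : N →ₗ[S] N) (g : ι), (∀ k, ∀ x ∈ 𝒩 k, f x ∈ 𝒩 (k + g)) →
      ∀ i x, f (P i x) = P (i + g) (f x) := by
    intro f g hf i x
    conv_rhs => rw [← hsum x, map_sum, map_sum]
    rw [Finset.sum_eq_single i]
    · rw [hself _ _ (hf _ _ (hmem i x))]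
    · intro k _ hk
      exact hzero _ _ (fun h' => hk (add_right_cancel h')) _ (hf _ _ (hmem k x))
    · simp
  refine ⟨fun i => MulOpposite.op (P i), ?_⟩
  constructor
  case mul_mem =>
    intro i j a b ha hb k x hx
    rw [← add_assoc]
    exact hb _ _ (ha _ _ hx)
  case one_mem =>
    intro k x hx
    rwa [add_zero]
  case exists_sum =>
    intro a
    have key : ∀ g, ∃ f : N →ₗ[S] N, ∀ x, f x = ∑ i, P (i + g) (a.unop (P i x)) := by
      intro g
      let t : N →ₗ[R] N := ∑ i, P (i + g) ∘ₗ (a.unop.restrictScalars R) ∘ₗ P i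
      have ht : ∀ x, t x = ∑ i, P (i + g) (a.unop (P i x)) := fun x => by
        simp [t, LinearMap.sum_apply]
      have ht' : ∀ k, ∀ x ∈ 𝒩 k, t x = P (k + g) (a.unop x) := fun k x hx => by
        rw [ht, Finset.sum_eq_single k, hself k x hx]
        · intro i _ hi
          rw [hzero _ _ hi.symm x hx, map_zero, map_zero]
        · simp
      have := hS.map_smul_of_homogeneous hN hP t.toAddMonoidHom fun m k c hc x hx => by
        change t (c • x) = c • t x
        rw [ht' _ _ hx, ht' _ _ (hN.smul_mem _ _ _ _ hc hx), map_smul, add_assoc]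
        exact hS.proj_smul hN hP hc _ _
      exact ⟨{ t with map_smul' := this }, ht⟩
    choose f hf using key
    refine ⟨fun g => MulOpposite.op (f g), fun g k x hx => ?_, ?_⟩
    · change f g x ∈ _
      rw [hf, Finset.sum_eq_single k]
      · exact hmem _ _
      · intro i _ hi
        rw [hzero _ _ hi.symm x hx, map_zero, map_zero]
      · simp
    · apply MulOpposite.unop_injective
      ext x
      rw [Finset.unop_sum, LinearMap.sum_apply]
      simp only [MulOpposite.unop_op, hf]
      rw [Finset.sum_comm]
      conv_rhs => rw [← hsum x, map_sum]
      refine Finset.sum_congr rfl fun i _ => ?_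
      exact (Equiv.sum_comp (Equiv.addLeft i) fun g => P g (a.unop (P i x))).trans (hsum _)
  case mul_self =>
    intro i
    rw [← MulOpposite.op_mul]
    congr 1
    ext x
    exact hself _ _ (hmem i x)
  case mul_of_ne =>
    intro i j hij
    rw [← MulOpposite.op_mul]
    apply MulOpposite.unop_injective
    ext x
    exact hzero _ _ hij _ (hmem i x)
  case sum_eq =>
    apply MulOpposite.unop_injective
    ext x
    rw [Finset.unop_sum, LinearMap.sum_apply]
    exact hsum x
  case e_mul =>
    intro g a ha i
    apply MulOpposite.unop_injective
    ext x
    exact hcomm a.unop g ha i x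
  case exists_mem =>
    intro i j b
    obtain ⟨f, hf, hf'⟩ := hS.exists_extension hN hW hP i j b.unop
    refine ⟨MulOpposite.op f, hf, ?_⟩
    apply MulOpposite.unop_injective
    ext x
    exact hf' x
  case eq_zero =>
    intro i g a ha h0
    have h1 : ∀ x, a.unop (P i x) = 0 := fun x => by
      have := congrArg (fun b => b.unop x) h0
      exact this
    apply MulOpposite.unop_injective
    ext x
    conv_lhs => rw [← hsum x, map_sum]
    refine Finset.sum_eq_zero fun k _ => ?_
    refine hS.eq_zero_of_smul_eq_zero hW (i := i - k) fun s hs => ?_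
    have h2 := hN.smul_mem _ _ _ _ hs (hmem k x)
    rw [sub_add_cancel] at h2
    rw [← map_smul, ← hself _ _ h2, h1]

/-- The left multiplication `S → End_R(S)`. -/
def mulEnd (R S : Type u) [CommRing R] [CommRing S] [Algebra R S] : S →ₐ[R] EndRing R S where
  toFun s := MulOpposite.op (LinearMap.mulLeft R s)
  map_one' := by rw [LinearMap.mulLeft_one]; rfl
  map_mul' a b := by
    rw [mul_comm, LinearMap.mulLeft_mul]; rfl
  map_zero' := by rw [LinearMap.mulLeft_zero_eq_zero]; rfl
  map_add' a b := by
    apply MulOpposite.unop_injective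
    ext x
    exact add_mul a b x
  commutes' r := by
    apply MulOpposite.unop_injective
    ext x
    exact (Algebra.smul_def r x).symm

/-- An S-linear endomorphism f of S is multiplication by f(1), so the extension of a map S_i → S_j
is given by an element of S_{j-i}. -/
lemma isSmashProduct_self (hW : IsWModule R S) : ∃ e, IsSmashProduct 𝒮 (mulEnd R S) e := by
  have hN := hS.isGradedModule
  obtain ⟨P, hP⟩ := hS.exists_isProjections_linear hN
  have hmem : ∀ i x, P i x ∈ 𝒮 i := hP.mem
  have hself : ∀ k, ∀ x ∈ 𝒮 k, P k x = x := hP.eq_self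
  have hzero : ∀ k l, k ≠ l → ∀ x ∈ 𝒮 k, P l x = 0 := hP.eq_zero
  have hsum : ∀ x, ∑ i, P i x = x := hP.sum_eq
  refine ⟨fun i => MulOpposite.op (P i), ?_⟩
  constructor
  case mul_mem => exact hS.mul_mem
  case one_mem => exact hS.one_mem
  case exists_sum => exact fun a => ⟨fun g => P g a, fun g => hmem g a, hsum a⟩
  case mul_self =>
    intro i
    rw [← MulOpposite.op_mul]
    congr 1
    ext x
    exact hself _ _ (hmem i x)
  case mul_of_ne =>
    intro i j hij
    rw [← MulOpposite.op_mul]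
    apply MulOpposite.unop_injective
    ext x
    exact hzero _ _ hij _ (hmem i x)
  case sum_eq =>
    apply MulOpposite.unop_injective
    ext x
    rw [Finset.unop_sum, LinearMap.sum_apply]
    exact hsum x
  case e_mul =>
    intro g a ha i
    apply MulOpposite.unop_injective
    ext x
    rw [add_comm i g]
    exact (hS.proj_smul hN hP ha i x).symm
  case exists_mem =>
    intro i j b
    obtain ⟨f, hf, hf'⟩ := hS.exists_extension hN hW hP i j b.unop
    have hf1 := hf 0 1 hS.one_mem
    rw [zero_add] at hf1
    refine ⟨f 1, hf1, ?_⟩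
    apply MulOpposite.unop_injective
    ext x
    refine Eq.trans ?_ (hf' x)
    change f 1 * P i x = f (P i x)
    rw [mul_comm, ← smul_eq_mul, ← map_smul, smul_eq_mul, mul_one]
  case eq_zero =>
    intro i g a ha h0
    have h1 : ∀ x, a * P i x = 0 := fun x => by
      have := congrArg (fun b => b.unop x) h0
      exact this
    refine hS.eq_zero_of_smul_eq_zero hW (i := i) fun s hs => ?_
    rw [smul_eq_mul, mul_comm, ← hself _ _ hs, h1]

end SmashProduct

end IsGVStronglyGraded

/-- N is Hom_S(N^*, S), and S is a w-module over R. -/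
lemma IsWModule.of_isReflexive_algebra [IsDomain R] (hS : IsWModule R S) {N : Type u}
    [AddCommGroup N] [Module R N] [Module S N] [IsScalarTower R S N] [Module.IsReflexive S N] :
    IsWModule R N :=
  (hS.linearMap S (Module.Dual S N)).of_linearEquiv ((Module.evalEquiv S N).restrictScalars R)

end StronglyGraded

/-! ### Fractional ideals -/

section Fractional

variable {R : Type u} [CommRing R] [IsDomain R]

local notation "K" => FractionRing R

lemma mem_one_div {J : Submodule R K} {x : K} :
    x ∈ 1 / J ↔ ∀ y ∈ J, x * y ∈ (1 : Submodule R K) :=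
  Submodule.mem_div_iff_forall_mul_mem

lemma mul_mem_one {x y : K} (hx : x ∈ (1 : Submodule R K)) (hy : y ∈ (1 : Submodule R K)) :
    x * y ∈ (1 : Submodule R K) := by
  have := Submodule.mul_mem_mul hx hy
  rwa [one_mul] at this

lemma mem_one_of_isGV {J : Ideal R} (hJ : IsGV J) {x : K}
    (hx : ∀ r ∈ J, r • x ∈ (1 : Submodule R K)) : x ∈ (1 : Submodule R K) := by
  obtain ⟨b, d, hd, rfl⟩ := IsFractionRing.div_surjective (A := R) x
  have hd0 : d ≠ 0 := nonZeroDivisors.ne_zero hd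
  have hdK : algebraMap R K d ≠ 0 := by simpa using hd0
  have h1 : d ∣ b := by
    refine hJ.2 d b hd0 fun r hr => ?_
    obtain ⟨c, hc⟩ := Submodule.mem_one.1 (hx r hr)
    refine ⟨c, IsFractionRing.injective R K ?_⟩
    rw [map_mul, map_mul, hc, Algebra.smul_def]
    field_simp
  obtain ⟨c, rfl⟩ := h1
  refine Submodule.mem_one.2 ⟨c, ?_⟩
  rw [map_mul, mul_div_cancel_left₀ _ hdK]

lemma isWModule_one_div (J : Submodule R K) : IsWModule R ↥(1 / J) where
  isTorsionFree := inferInstance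
  exists_eq_smul {I} hI {a} ha {y} H := by
    have haK : algebraMap R K a ≠ 0 := by simpa using ha
    refine ⟨⟨(algebraMap R K a)⁻¹ * y, mem_one_div.2 fun c hc => mem_one_of_isGV hI fun r hr => ?_⟩,
      Subtype.ext ?_⟩
    · obtain ⟨z, hz⟩ := H r hr
      have h1 : r • (y : K) = a • (z : K) := congrArg Subtype.val hz
      have h2 : r • ((algebraMap R K a)⁻¹ * (y : K) * c) = z * c := by
        rw [Algebra.smul_def] at h1 ⊢
        rw [Algebra.smul_def] at h1
        field_simp
        linear_combination c * h1
      rw [h2]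
      exact mem_one_div.1 z.2 c hc
    · rw [Submodule.coe_smul, Algebra.smul_def, mul_inv_cancel_left₀ haK]

lemma finite_one_div [IsNoetherianRing R] {J : Submodule R K} (hJ : J ≠ ⊥) :
    Module.Finite R ↥(1 / J) := by
  obtain ⟨l, hl, hl0⟩ := Submodule.exists_mem_ne_zero_of_ne_bot hJ
  have h1 : 1 / J ≤ (1 : Submodule R K).map (LinearMap.mulLeft R l⁻¹) := fun x hx =>
    ⟨x * l, mem_one_div.1 hx l hl, by
      rw [LinearMap.mulLeft_apply, mul_comm x, inv_mul_cancel_left₀ hl0]⟩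
  have h2 : ((1 : Submodule R K).map (LinearMap.mulLeft R l⁻¹)).FG := by
    refine Submodule.FG.map _ ?_
    rw [Submodule.one_eq_span]
    exact Submodule.fg_span_singleton 1
  have := isNoetherian_of_fg_of_noetherian _ h2
  exact Module.Finite.iff_fg.2 (isNoetherian_submodule.1 this _ h1)

variable (R) in
/-- The identification of the fractional ideal `1` with `R`. -/
noncomputable def oneEquiv : (1 : Submodule R K) ≃ₗ[R] R :=
  (LinearEquiv.ofEq _ _ Submodule.one_eq_range).trans
    (LinearEquiv.ofInjective (Algebra.linearMap R K) (IsFractionRing.injective R K)).symm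

lemma algebraMap_oneEquiv (x : (1 : Submodule R K)) : algebraMap R K (oneEquiv R x) = x :=
  congrArg Subtype.val ((LinearEquiv.ofInjective (Algebra.linearMap R K)
    (IsFractionRing.injective R K)).apply_symm_apply _)

/-- The pairing of `R : J` with `J`. -/
noncomputable def oneDivToDual (J : Submodule R K) : ↥(1 / J) →ₗ[R] Module.Dual R J where
  toFun c := (oneEquiv R).toLinearMap ∘ₗ LinearMap.restrict (LinearMap.mulLeft R (c : K))
    (mem_one_div.1 c.2)
  map_add' c d := by
    ext y
    apply IsFractionRing.injective R K
    rw [LinearMap.add_apply, map_add]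
    simp only [LinearMap.comp_apply, LinearEquiv.coe_coe, algebraMap_oneEquiv]
    exact add_mul _ _ _
  map_smul' r c := by
    ext y
    apply IsFractionRing.injective R K
    rw [LinearMap.smul_apply, smul_eq_mul, map_mul]
    simp only [LinearMap.comp_apply, LinearEquiv.coe_coe, algebraMap_oneEquiv, RingHom.id_apply]
    rw [← Algebra.smul_def]
    exact smul_mul_assoc r (c : K) (y : K)

lemma algebraMap_oneDivToDual (J : Submodule R K) (c : ↥(1 / J)) (y : J) :
    algebraMap R K (oneDivToDual J c y) = c * y :=
  algebraMap_oneEquiv _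

/-- Any two elements of K are linearly dependent over R, so f is multiplication by f(y₀)/y₀ for any
nonzero y₀ ∈ J. -/
lemma exists_eq_mul_of_dual (J : Submodule R K) (f : Module.Dual R J) :
    ∃ c : K, ∀ y : J, algebraMap R K (f y) = c * y := by
  by_cases hJ : J = ⊥
  · refine ⟨0, fun y => ?_⟩
    have : y = 0 := Subtype.ext ((Submodule.mem_bot R).1 (hJ ▸ y.2))
    rw [this]; simp
  obtain ⟨y₀, hy₀, h0⟩ := Submodule.exists_mem_ne_zero_of_ne_bot hJ
  refine ⟨algebraMap R K (f ⟨y₀, hy₀⟩) / y₀, fun y => ?_⟩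
  obtain ⟨b, a, ha, hba⟩ := IsFractionRing.div_surjective (A := R) ((y : K) / y₀)
  have haK : algebraMap R K a ≠ 0 := by simpa using nonZeroDivisors.ne_zero ha
  have h1 : a • y = b • (⟨y₀, hy₀⟩ : J) := Subtype.ext (by
    change a • (y : K) = b • y₀
    rw [Algebra.smul_def, Algebra.smul_def]
    field_simp at hba
    linear_combination -hba)
  have h2 := congrArg (fun t => algebraMap R K (f t)) h1
  simp only [map_smul, smul_eq_mul, map_mul] at h2
  rw [div_mul_eq_mul_div, eq_div_iff h0]
  apply mul_left_cancel₀ haK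
  field_simp at hba
  linear_combination y₀ * h2 + algebraMap R K (f ⟨y₀, hy₀⟩) * hba

lemma bijective_oneDivToDual {J : Submodule R K} (hJ : J ≠ ⊥) :
    Function.Bijective (oneDivToDual J) := by
  obtain ⟨y₀, hy₀, h0⟩ := Submodule.exists_mem_ne_zero_of_ne_bot hJ
  constructor
  · intro c d hcd
    have h1 := congrArg (algebraMap R K) (LinearMap.congr_fun hcd ⟨y₀, hy₀⟩)
    rw [algebraMap_oneDivToDual, algebraMap_oneDivToDual] at h1
    exact Subtype.ext (mul_right_cancel₀ h0 h1)
  · intro f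
    obtain ⟨c, hc⟩ := exists_eq_mul_of_dual J f
    refine ⟨⟨c, mem_one_div.2 fun y hy => Submodule.mem_one.2 ⟨_, hc ⟨y, hy⟩⟩⟩, ?_⟩
    ext y
    apply IsFractionRing.injective R K
    rw [algebraMap_oneDivToDual, hc]

end Fractional

/-! ### The structure of the canonical cover -/

namespace CoverDatum

variable {R : Type u} [CommRing R] [IsDomain R] {ω : Type u} [AddCommGroup ω] [Module R ω] {n : ℕ}
  (D : CoverDatum R ω n)

local notation "K" => FractionRing R

lemma ideal_pow_le_one (k : ℕ) : D.ideal ^ k ≤ 1 := by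
  have h : D.ideal ≤ 1 := by
    rintro _ ⟨r, -, rfl⟩
    exact Submodule.mem_one.2 ⟨r, rfl⟩
  induction k with
  | zero => rw [pow_zero]
  | succ k ih =>
    rw [pow_succ]
    exact (mul_le_mul' ih h).trans (one_mul _).le

lemma one_mem_one_div (k : ℕ) : (1 : K) ∈ 1 / D.ideal ^ k :=
  mem_one_div.2 fun y hy => by rw [one_mul]; exact D.ideal_pow_le_one k hy

lemma one_div_ne_bot (k : ℕ) : 1 / D.ideal ^ k ≠ ⊥ := fun h =>
  one_ne_zero ((Submodule.mem_bot R).1 (h ▸ D.one_mem_one_div k))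

lemma ideal_pow_ne_bot [Nontrivial ω] (k : ℕ) : D.ideal ^ k ≠ ⊥ := by
  obtain ⟨w, hw⟩ := exists_ne (0 : ω)
  intro h
  have h1 : algebraMap R K (D.emb w) ∈ D.ideal := ⟨_, ⟨w, rfl⟩, rfl⟩
  have h2 := Submodule.pow_mem_pow _ h1 k
  rw [h, Submodule.mem_bot] at h2
  refine hw (D.emb_injective ?_)
  rw [map_zero]
  simpa using eq_zero_of_pow_eq_zero h2

lemma divHull_ne_bot [Nontrivial ω] (k : ℕ) : divHull (D.ideal ^ k) ≠ ⊥ := fun h =>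
  D.ideal_pow_ne_bot k (le_bot_iff.1 (h ▸ le_divHull _))

lemma divHull_le_one (k : ℕ) : divHull (D.ideal ^ k) ≤ 1 := fun x hx => by
  have := mem_divHull.1 hx 1 fun a ha => by rw [one_mul]; exact D.ideal_pow_le_one k ha
  rwa [mul_one] at this

/-- Since (I^n)^{**} = q⁻¹R, its dual (R : I^n) is qR. Induction on k through (R : I^n I^{nk}) = ((R
: I^n) : I^{nk}) gives (R : I^{nk}) = q^k R. -/
lemma mem_one_div_pow_mul (k : ℕ) (u : K) :
    u ∈ 1 / D.ideal ^ (n * k) ↔ u * ((D.q⁻¹ : Kˣ) : K) ^ k ∈ (1 : Submodule R K) := by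
  have hq : ∀ x : K, x ∈ divHull (D.ideal ^ n) ↔ (D.q : K) * x ∈ (1 : Submodule R K) := by
    intro x
    have h := D.map_q
    change (divHull (D.ideal ^ n)).map _ = 1 at h
    rw [← h]
    constructor
    · exact fun hx => ⟨x, hx, rfl⟩
    · rintro ⟨y, hy, hxy⟩
      rwa [← mul_left_cancel₀ D.q.ne_zero hxy]
  have h1 : ∀ u : K, u ∈ 1 / D.ideal ^ n ↔ u * ((D.q⁻¹ : Kˣ) : K) ∈ (1 : Submodule R K) := by
    intro u
    constructor
    · intro hu
      have h2 : ((D.q⁻¹ : Kˣ) : K) ∈ divHull (D.ideal ^ n) := by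
        rw [hq, Units.mul_inv]
        exact Submodule.mem_one.2 ⟨1, map_one _⟩
      rw [mul_comm]
      exact mem_divHull.1 h2 u (mem_one_div.1 hu)
    · intro hu
      refine mem_one_div.2 fun c hc => ?_
      have h2 := mul_mem_one hu ((hq c).1 (le_divHull _ hc))
      rwa [show u * ((D.q⁻¹ : Kˣ) : K) * ((D.q : K) * c) =
        u * c * (((D.q⁻¹ : Kˣ) : K) * D.q) by ring, Units.inv_mul, mul_one] at h2
  induction k generalizing u with
  | zero =>
    rw [mul_zero, pow_zero, pow_zero, mul_one]
    refine ⟨fun hu => ?_, fun hu => mem_one_div.2 fun y hy => mul_mem_one hu hy⟩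
    have := mem_one_div.1 hu 1 (Submodule.mem_one.2 ⟨1, map_one _⟩)
    rwa [mul_one] at this
  | succ k ih =>
    have h2 : u ∈ 1 / D.ideal ^ (n * (k + 1)) ↔ u * ((D.q⁻¹ : Kˣ) : K) ∈ 1 / D.ideal ^ (n * k) := by
      rw [mul_add, mul_one, pow_add]
      constructor
      · intro hu
        refine mem_one_div.2 fun c hc => ?_
        rw [mul_right_comm, ← h1]
        refine mem_one_div.2 fun d hd => ?_
        rw [mul_assoc]
        exact mem_one_div.1 hu _ (Submodule.mul_mem_mul hc hd)
      · intro hu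
        refine mem_one_div.2 fun c hc => ?_
        induction hc using Submodule.mul_induction_on' with
        | mem_mul_mem c hc d hd =>
          have h3 := mem_one_div.1 hu c hc
          rw [mul_right_comm, ← h1] at h3
          rw [← mul_assoc]
          exact mem_one_div.1 h3 d hd
        | add a _ b _ ha hb => rw [mul_add]; exact add_mem ha hb
    exact h2.trans ((ih _).trans (by rw [pow_succ', mul_assoc]))

/-- As I^a I^b = I^{nk} has dual q^k R, the powers I^a and I^b are mutually inverse up to hulls and
the factor q^k. -/
lemma mem_divHull_iff_of_add_eq {a b k : ℕ} (hab : a + b = n * k) (x : K) :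
    x ∈ divHull (D.ideal ^ b) ↔ (D.q : K) ^ k * x ∈ 1 / D.ideal ^ a := by
  constructor
  · intro hx
    refine mem_one_div.2 fun c hc => ?_
    rw [show (D.q : K) ^ k * x * c = x * ((D.q : K) ^ k * c) by ring]
    refine mem_divHull.1 hx _ fun d hd => ?_
    rw [mul_assoc]
    have h1 : (D.q : K) ^ k ∈ 1 / D.ideal ^ (n * k) := by
      rw [mem_one_div_pow_mul, ← mul_pow, Units.mul_inv, one_pow]
      exact Submodule.mem_one.2 ⟨1, map_one _⟩
    refine mem_one_div.1 h1 _ ?_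
    rw [← hab, pow_add]
    exact Submodule.mul_mem_mul hc hd
  · intro hx
    refine mem_divHull.2 fun w hw => ?_
    have h1 : (D.q : K) ^ k * x * w ∈ 1 / D.ideal ^ (n * k) := by
      rw [← hab, pow_add]
      refine mem_one_div.2 fun c hc => ?_
      induction hc using Submodule.mul_induction_on' with
      | mem_mul_mem c hc d hd =>
        have := mul_mem_one (mem_one_div.1 hx c hc) (hw d hd)
        convert this using 1
        ring
      | add a _ b _ ha hb => rw [mul_add]; exact add_mem ha hb
    rw [mem_one_div_pow_mul] at h1
    convert h1 using 1
    rw [show (D.q : K) ^ k * x * w * ((D.q⁻¹ : Kˣ) : K) ^ k =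
      x * w * ((D.q : K) * ((D.q⁻¹ : Kˣ) : K)) ^ k by ring, Units.mul_inv, one_pow, mul_one]

/-- Multiplication by `q ^ k` is an isomorphism from `(I ^ b)^{**}` to `(I ^ a)^*` for
`a + b = k n`. -/
lemma nonempty_divHull_equiv {a b k : ℕ} (hab : a + b = n * k) :
    Nonempty (divHull (D.ideal ^ b) ≃ₗ[R] ↥(1 / D.ideal ^ a)) := by
  have h := D.mem_divHull_iff_of_add_eq hab
  have hq : (D.q : K) ^ k ≠ 0 := pow_ne_zero _ D.q.ne_zero
  refine ⟨LinearEquiv.ofBijective (LinearMap.restrict (LinearMap.mulLeft R ((D.q : K) ^ k))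
    fun x hx => (h x).1 hx) ⟨fun x y hxy => ?_, fun y => ?_⟩⟩
  · exact Subtype.ext (mul_left_cancel₀ hq (congrArg Subtype.val hxy))
  · have hy : (D.q : K) ^ k * (((D.q : K) ^ k)⁻¹ * y) = y := mul_inv_cancel_left₀ hq _
    exact ⟨⟨((D.q : K) ^ k)⁻¹ * y, (h _).2 (by rw [hy]; exact y.2)⟩, Subtype.ext hy⟩

lemma isWModule_piece (i : ZMod n) : IsWModule R (D.piece i) := isWModule_one_div _

variable [NeZero n]

/-- The cover as a product of its graded pieces. -/
noncomputable def coverEquivPi : D.Cover ≃ₗ[R] ∀ i : ZMod n, D.piece i :=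
  DirectSum.linearEquivFunOnFintype R (ZMod n) fun i => D.piece i

lemma isWModule_cover : IsWModule R D.Cover :=
  (IsWModule.pi fun i => D.isWModule_piece i).of_linearEquiv D.coverEquivPi

lemma finite_cover [IsNoetherianRing R] : Module.Finite R D.Cover := by
  have := fun i : ZMod n => finite_one_div (D.one_div_ne_bot i.val)
  have : ∀ i, Module.Finite R (D.piece i) := this
  exact Module.Finite.equiv D.coverEquivPi.symm

/-- The projection of the cover onto a graded piece. -/
noncomputable def component (i : ZMod n) : D.Cover →ₗ[R] D.piece i :=
  DirectSum.component R (ZMod n) (fun i => D.piece i) i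

lemma component_incl_self (i : ZMod n) (x : D.piece i) : D.component i (D.incl i x) = x :=
  DirectSum.component.lof_self (ι := ZMod n) (M := fun i => D.piece i) R i x

lemma component_incl_of_ne {i j : ZMod n} (h : j ≠ i) (x : D.piece i) :
    D.component j (D.incl i x) = 0 := by
  refine (DirectSum.component.of (ι := ZMod n) (M := fun i => D.piece i) R _ _ x).trans ?_
  rw [dif_neg h.symm]

lemma sum_incl_component (x : D.Cover) : ∑ i, D.incl i (D.component i x) = x :=
  DirectSum.sum_univ_of (x : ⨁ i : ZMod n, D.piece i)

lemma isProjections_grading :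
    IsProjections D.grading fun i => (D.incl i ∘ₗ D.component i).toAddMonoidHom where
  mem i x := ⟨D.component i x, rfl⟩
  eq_self i x hx := by
    obtain ⟨x, rfl⟩ := hx
    exact congrArg (D.incl i) (D.component_incl_self i x)
  eq_zero i j hij x hx := by
    obtain ⟨x, rfl⟩ := hx
    exact (congrArg (D.incl j) (D.component_incl_of_ne hij.symm x)).trans (map_zero (D.incl j))
  sum_eq := D.sum_incl_component

lemma algebraMap_eq (r : R) :
    algebraMap R D.Cover r = D.incl 0 (r • ⟨1, D.one_mem_piece⟩) := rfl

/-- A functional on S_i is multiplication by some c ∈ (R : I^i), and q^{-k} c lies in S_{-i}, where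
q^k is the cocycle of (i, -i). The product in S of x ∈ S_i with q^{-k} c is therefore the value cx,
so S_i S_{-i} contains the trace ideal of S_i. -/
lemma isGVStronglyGraded [IsNoetherianRing R] [IsIntegrallyClosed R] [Nontrivial ω] :
    IsGVStronglyGraded R D.grading where
  isInternal := D.isProjections_grading.isInternal
  mul_mem := by
    rintro i j _ _ ⟨x, rfl⟩ ⟨y, rfl⟩
    exact ⟨_, (D.incl_mul_incl x y).symm⟩
  mem_zero_iff s := by
    constructor
    · rintro ⟨⟨x, hx⟩, rfl⟩
      have h1 : x ∈ (1 : Submodule R K) := by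
        have := hx
        rwa [piece, ZMod.val_zero, pow_zero, divHull_one] at this
      obtain ⟨r, rfl⟩ := Submodule.mem_one.1 h1
      refine ⟨r, ?_⟩
      rw [algebraMap_eq]
      exact congrArg (D.incl 0) (Subtype.ext (Algebra.algebraMap_eq_smul_one r).symm)
    · rintro ⟨r, rfl⟩
      exact ⟨_, (D.algebraMap_eq r).symm⟩
  isGV i := by
    have hfin : Module.Finite R (D.piece i) := finite_one_div (D.one_div_ne_bot i.val)
    let f : D.piece i →ₗ[R] R :=
      (oneEquiv R).toLinearMap ∘ₗ Submodule.inclusion (D.divHull_le_one i.val)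
    have hf : f ≠ 0 := fun h => by
      obtain ⟨x, hx, hx0⟩ := Submodule.exists_mem_ne_zero_of_ne_bot (D.divHull_ne_bot i.val)
      have h1 : f ⟨x, hx⟩ = 0 := by rw [h]; rfl
      have h2 : algebraMap R K (f ⟨x, hx⟩) = x := algebraMap_oneEquiv _
      rw [h1, map_zero] at h2
      exact hx0 h2.symm
    refine (isGV_traceIdeal hf).mono (Ideal.span_mono ?_)
    rintro _ ⟨f, x, rfl⟩
    obtain ⟨c, hc⟩ := exists_eq_mul_of_dual _ f
    have hsum : (i.val + (-i).val) % n = 0 := by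
      rw [← ZMod.val_add, add_neg_cancel, ZMod.val_zero]
    have hk : i.val + (-i).val = n * ((i.val + (-i).val) / n) :=
      (Nat.mul_div_cancel' (Nat.dvd_of_mod_eq_zero hsum)).symm
    set k := (i.val + (-i).val) / n with hkdef
    have hq : (D.q : K) ^ k ≠ 0 := pow_ne_zero _ D.q.ne_zero
    have hy : ((D.q : K) ^ k)⁻¹ * c ∈ D.piece (-i) := by
      refine (D.mem_divHull_iff_of_add_eq hk _).2 ?_
      rw [mul_inv_cancel_left₀ hq]
      refine mem_one_div.2 fun y hy => ?_
      rw [← hc ⟨y, le_divHull _ hy⟩]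
      exact Submodule.mem_one.2 ⟨_, rfl⟩
    refine ⟨D.incl i x, ⟨x, rfl⟩, D.incl (-i) ⟨_, hy⟩, ⟨_, rfl⟩, ?_⟩
    rw [D.incl_mul_incl, algebraMap_eq]
    -- The product lives in the component of index i + (-i), which has to be identified with the
    -- component 0.
    have h0 : ∀ (j : ZMod n) (h : j = 0) (z : D.piece j) (w : D.piece 0), (z : K) = w →
        D.incl 0 w = D.incl j z := by
      rintro j rfl z w hzw
      rw [Subtype.ext hzw]
    refine h0 _ (add_neg_cancel i) _ _ ?_
    change (D.q : K) ^ k * (x * (((D.q : K) ^ k)⁻¹ * c)) = (f x) • (1 : K)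
    rw [Algebra.smul_def, mul_one, hc]
    field_simp

end CoverDatum

/-! ### Duals of tensor products -/

section Tensor

variable {R : Type u} [CommRing R] {P Q X Y : Type u} [AddCommGroup P] [Module R P]
  [AddCommGroup Q] [Module R Q] [AddCommGroup X] [Module R X] [AddCommGroup Y] [Module R Y]

variable (X) in
/-- The dual of `P ⊗ X` depends only on the dual of `P`. -/
noncomputable def dualTensorCongr (e : Module.Dual R P ≃ₗ[R] Module.Dual R Q) :
    Module.Dual R (P ⊗[R] X) ≃ₗ[R] Module.Dual R (Q ⊗[R] X) :=
  (LinearEquiv.congrLeft R R (TensorProduct.comm R P X)).trans <|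
    (TensorProduct.lift.equiv (.id R) X P R).symm.trans <|
      (LinearEquiv.congrRight e).trans <|
        (TensorProduct.lift.equiv (.id R) X Q R).trans
          (LinearEquiv.congrLeft R R (TensorProduct.comm R X Q))

/-- Isomorphic modules have isomorphic duals. -/
noncomputable def dualCongr (e : X ≃ₗ[R] Y) : Module.Dual R X ≃ₗ[R] Module.Dual R Y :=
  LinearEquiv.congrLeft R R e

/-- A surjection with torsion kernel is an isomorphism on duals. -/
lemma bijective_lcomp_of_surjective [IsDomain R] (f : X →ₗ[R] Y) (hf : Function.Surjective f)
    (hker : ∀ x, f x = 0 → ∃ a : R, a ≠ 0 ∧ a • x = 0) :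
    Function.Bijective (LinearMap.lcomp R R f) := by
  refine ⟨fun g h hgh => LinearMap.ext fun y => ?_, fun g => ?_⟩
  · obtain ⟨x, rfl⟩ := hf y
    exact LinearMap.congr_fun hgh x
  · have hg : LinearMap.ker f ≤ LinearMap.ker g := fun x hx => by
      obtain ⟨a, ha, h⟩ := hker x hx
      have h1 : a * g x = 0 := by rw [← smul_eq_mul, ← map_smul, h, map_zero]
      exact (mul_eq_zero.1 h1).resolve_left ha
    refine ⟨(LinearMap.ker f).liftQ g hg ∘ₗ (f.quotKerEquivOfSurjective hf).symm.toLinearMap, ?_⟩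
    ext x
    have h1 : (f.quotKerEquivOfSurjective hf).symm (f x) = Submodule.Quotient.mk x := by
      rw [LinearEquiv.symm_apply_eq]; rfl
    change (LinearMap.ker f).liftQ g hg ((f.quotKerEquivOfSurjective hf).symm (f x)) = g x
    rw [h1]; rfl

variable [IsDomain R]

local notation "K" => FractionRing R

/-- The product of an element of `J` with an element of `R : J`. -/
noncomputable def dualPairing (J : Submodule R K) : J →ₗ[R] ↥(1 / J) →ₗ[R] R :=
  (oneDivToDual J).flip

lemma algebraMap_dualPairing (J : Submodule R K) (p : J) (q : ↥(1 / J)) :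
    algebraMap R K (dualPairing J p q) = q * p :=
  algebraMap_oneDivToDual J q p

lemma dualPairing_smul_left (J : Submodule R K) (p p' : J) (q : ↥(1 / J)) :
    dualPairing J p q • p' = dualPairing J p' q • p := by
  refine Subtype.ext ?_
  rw [Submodule.coe_smul, Submodule.coe_smul, Algebra.smul_def, Algebra.smul_def,
    algebraMap_dualPairing, algebraMap_dualPairing]
  ring

lemma dualPairing_smul_right (J : Submodule R K) (p : J) (q q' : ↥(1 / J)) :
    dualPairing J p q • q' = dualPairing J p q' • q := by
  refine Subtype.ext ?_
  rw [Submodule.coe_smul, Submodule.coe_smul, Algebra.smul_def, Algebra.smul_def,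
    algebraMap_dualPairing, algebraMap_dualPairing]
  ring

variable (X) in
/-- The natural map from `J ⊗ X` to `Hom(R : J, X)`. -/
noncomputable def tensorToHom (J : Submodule R K) : J ⊗[R] X →ₗ[R] ↥(1 / J) →ₗ[R] X :=
  TensorProduct.lift <| LinearMap.mk₂ R
    (fun p x => LinearMap.toSpanSingleton R X x ∘ₗ dualPairing J p)
    (fun p p' x => by ext q; simp [add_smul]) (fun r p x => by ext q; simp [mul_smul])
    (fun p x x' => by ext q; simp) (fun r p x => by ext q; simp [smul_comm r])

lemma tensorToHom_tmul_apply (J : Submodule R K) (p : J) (x : X) (q : ↥(1 / J)) :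
    tensorToHom X J (p ⊗ₜ x) q = dualPairing J p q • x := rfl

/-- Because J has rank one, ⟨p, q⟩ p' = ⟨p', q⟩ p. Hence the values ⟨p, q⟩, which generate the trace
ideal of J, annihilate the kernel of `tensorToHom`; `tensorToHom_tmul_eq_smul` does the same for the
cokernel. -/
lemma dualPairing_smul_tensor (J : Submodule R K) (p : J) (q : ↥(1 / J)) (t : J ⊗[R] X) :
    dualPairing J p q • t = p ⊗ₜ tensorToHom X J t q := by
  induction t with
  | zero => simp
  | tmul p' x =>
    rw [TensorProduct.smul_tmul', dualPairing_smul_left, tensorToHom_tmul_apply,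
      TensorProduct.tmul_smul, TensorProduct.smul_tmul']
  | add t t' ht ht' => rw [smul_add, ht, ht', map_add, LinearMap.add_apply, TensorProduct.tmul_add]

lemma tensorToHom_tmul_eq_smul (J : Submodule R K) (p : J) (q : ↥(1 / J)) (h : ↥(1 / J) →ₗ[R] X) :
    tensorToHom X J (p ⊗ₜ h q) = dualPairing J p q • h := by
  ext q'
  rw [tensorToHom_tmul_apply, LinearMap.smul_apply, ← map_smul, ← map_smul,
    dualPairing_smul_right]

lemma exists_dualPairing_eq (J : Submodule R K) (f : Module.Dual R J) :
    ∃ q, ∀ p, dualPairing J p q = f p := by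
  obtain ⟨c, hc⟩ := exists_eq_mul_of_dual J f
  have hmem : c ∈ 1 / J := mem_one_div.2 fun y hy => Submodule.mem_one.2 ⟨_, hc ⟨y, hy⟩⟩
  refine ⟨⟨c, hmem⟩, fun p => IsFractionRing.injective R K ?_⟩
  rw [algebraMap_dualPairing, hc]

variable [IsNoetherianRing R] [IsIntegrallyClosed R]

lemma bijective_lcomp_tensorToHom {J : Submodule R K} [Module.Finite R J] (hJ : J ≠ ⊥)
    (hJ' : 1 / J ≠ ⊥) : Function.Bijective (LinearMap.lcomp R R (tensorToHom X J)) := by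
  obtain ⟨p₀, hp₀, hp₀0⟩ := Submodule.exists_mem_ne_zero_of_ne_bot hJ
  obtain ⟨q₀, hq₀, hq₀0⟩ := Submodule.exists_mem_ne_zero_of_ne_bot hJ'
  have hf : (dualPairing J).flip ⟨q₀, hq₀⟩ ≠ 0 := fun h => by
    have h1 := algebraMap_dualPairing J ⟨p₀, hp₀⟩ ⟨q₀, hq₀⟩
    have h2 : dualPairing J ⟨p₀, hp₀⟩ ⟨q₀, hq₀⟩ = 0 := LinearMap.congr_fun h ⟨p₀, hp₀⟩
    rw [h2, map_zero] at h1
    exact mul_ne_zero hq₀0 hp₀0 h1.symm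
  refine IsWModule.bijective_lcomp (M := J ⊗[R] X) (N := ↥(1 / J) →ₗ[R] X) (isWModule_self R) _ (isGV_traceIdeal hf) (fun t ht r hr => ?_)
    fun h r hr => ?_
  · induction hr using Submodule.span_induction with
    | mem r hr =>
      obtain ⟨f, p, rfl⟩ := hr
      obtain ⟨q, hq⟩ := exists_dualPairing_eq J f
      rw [← hq, dualPairing_smul_tensor, ht, LinearMap.zero_apply, TensorProduct.tmul_zero]
    | zero => exact zero_smul _ _
    | add r s _ _ hr hs => rw [add_smul, hr, hs, add_zero]
    | smul c r _ hr => rw [smul_assoc, hr, smul_zero]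
  · rw [← LinearMap.mem_range]
    induction hr using Submodule.span_induction with
    | mem r hr =>
      obtain ⟨f, p, rfl⟩ := hr
      obtain ⟨q, hq⟩ := exists_dualPairing_eq J f
      exact ⟨p ⊗ₜ h q, by rw [tensorToHom_tmul_eq_smul, hq]⟩
    | zero => rw [zero_smul]; exact zero_mem _
    | add r s _ _ hr hs => rw [add_smul]; exact add_mem hr hs
    | smul c r _ hr => rw [smul_assoc]; exact Submodule.smul_mem _ c hr

/-- If `P` and the fractional ideal `J` have isomorphic duals, then `(P ⊗ X)^{**}` is
`Hom(R : J, X)`. -/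
lemma nonempty_biDual_tensor_equiv {J : Submodule R K} [Module.Finite R J] (hJ : J ≠ ⊥)
    (hJ' : 1 / J ≠ ⊥) (e : Nonempty (Module.Dual R P ≃ₗ[R] ↥(1 / J))) [Module.Finite R X]
    (hX : IsWModule R X) :
    Nonempty (BiDual R (P ⊗[R] X) ≃ₗ[R] (↥(1 / J) →ₗ[R] X)) := by
  obtain ⟨e⟩ := e
  have := finite_one_div hJ
  have := (hX.linearMap R ↥(1 / J)).isReflexive
  -- (P ⊗ X)^* ≅ (J ⊗ X)^* ≅ Hom(R : J, X)^*; now dualize and use that Hom(R : J, X) is reflexive.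
  exact ⟨(dualCongr ((dualTensorCongr X (e.trans (LinearEquiv.ofBijective _
    (bijective_oneDivToDual hJ)))).trans (LinearEquiv.ofBijective _
      (bijective_lcomp_tensorToHom hJ hJ')).symm)).trans (Module.evalEquiv R _).symm⟩

end Tensor

/-! ### Reflexive powers -/

namespace CoverDatum

variable {R : Type u} [CommRing R] [IsDomain R] {ω : Type u} [AddCommGroup ω] [Module R ω] {n : ℕ}
  (D : CoverDatum R ω n)

local notation "K" => FractionRing R

lemma emb_smul_comm (x y : ω) : D.emb x • y = D.emb y • x :=
  D.emb_injective (by rw [map_smul, map_smul, smul_eq_mul, smul_eq_mul, mul_comm])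

lemma pow_emb_smul_tprod (m : ℕ) (w : ω) (v : Fin m → ω) :
    D.emb w ^ m • PiTensorProduct.tprod R v =
      (∏ k, D.emb (v k)) • PiTensorProduct.tprod R fun _ => w := by
  rw [← MultilinearMap.map_smul_univ, funext fun k => D.emb_smul_comm (v k) w,
    MultilinearMap.map_smul_univ, Finset.prod_const, Finset.card_univ, Fintype.card_fin]

/-- The map from the tensor power of `ω` to the power of the ideal. -/
noncomputable def tensorPowerToIdeal (m : ℕ) : ⨂[R]^m ω →ₗ[R] ↥(D.ideal ^ m) :=
  LinearMap.codRestrict _ (PiTensorProduct.lift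
    ((MultilinearMap.mkPiAlgebra R (Fin m) K).compLinearMap fun _ =>
      Algebra.linearMap R K ∘ₗ D.emb)) fun t => by
    induction t using PiTensorProduct.induction_on with
    | smul_tprod r v =>
      rw [map_smul, PiTensorProduct.lift.tprod]
      refine Submodule.smul_mem _ r ?_
      rw [Submodule.pow_eq_span_pow_set]
      refine Submodule.subset_span (Set.mem_pow.2 ⟨fun k => ⟨_, D.emb (v k), ⟨v k, rfl⟩, rfl⟩, ?_⟩)
      rw [List.prod_ofFn]
      rfl
    | add x y hx hy => rw [map_add]; exact add_mem hx hy

lemma coe_tensorPowerToIdeal_tprod (m : ℕ) (v : Fin m → ω) :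
    (D.tensorPowerToIdeal m (PiTensorProduct.tprod R v) : K) =
      algebraMap R K (∏ k, D.emb (v k)) := by
  rw [map_prod]
  exact PiTensorProduct.lift.tprod v

lemma surjective_tensorPowerToIdeal (m : ℕ) : Function.Surjective (D.tensorPowerToIdeal m) := by
  have h : D.ideal ^ m ≤ (LinearMap.range (D.tensorPowerToIdeal m)).map (D.ideal ^ m).subtype := by
    conv_lhs => rw [Submodule.pow_eq_span_pow_set]
    rw [Submodule.span_le]
    intro y hy
    obtain ⟨f, rfl⟩ := Set.mem_pow.1 hy
    choose r hr hf using fun k => (f k).2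
    choose v hv using hr
    refine ⟨_, ⟨PiTensorProduct.tprod R v, rfl⟩, ?_⟩
    rw [Submodule.subtype_apply, coe_tensorPowerToIdeal_tprod, map_prod, List.prod_ofFn]
    refine Finset.prod_congr rfl fun k _ => ?_
    rw [hv]
    exact hf k
  intro y
  obtain ⟨z, ⟨t, rfl⟩, hz⟩ := h y.2
  exact ⟨t, Subtype.ext hz⟩

/-- Since emb(x) y = emb(y) x, the tensor power has rank one: up to the factor emb(w)^m, a tensor is
its image in I^m times w ⊗ ⋯ ⊗ w. So the kernel of the map to I^m is torsion and disappears in the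
dual. -/
lemma exists_pow_emb_smul_eq (m : ℕ) (w : ω) (t : ⨂[R]^m ω) :
    ∃ r : R, algebraMap R K r = D.tensorPowerToIdeal m t ∧
      D.emb w ^ m • t = r • PiTensorProduct.tprod R fun _ => w := by
  induction t using PiTensorProduct.induction_on with
  | smul_tprod r v =>
    refine ⟨r * ∏ k, D.emb (v k), ?_, ?_⟩
    · rw [map_smul, Submodule.coe_smul, coe_tensorPowerToIdeal_tprod, map_mul, Algebra.smul_def]
    · rw [smul_comm, pow_emb_smul_tprod, mul_smul]
  | add x y hx hy =>
    obtain ⟨r, hr, hr'⟩ := hx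
    obtain ⟨s, hs, hs'⟩ := hy
    exact ⟨r + s, by rw [map_add, hr, hs, map_add, Submodule.coe_add],
      by rw [smul_add, hr', hs', add_smul]⟩

variable [Nontrivial ω]

lemma bijective_lcomp_tensorPowerToIdeal (m : ℕ) :
    Function.Bijective (LinearMap.lcomp R R (D.tensorPowerToIdeal m)) := by
  obtain ⟨w, hw⟩ := exists_ne (0 : ω)
  have hw0 : D.emb w ≠ 0 := fun h => hw (D.emb_injective (h.trans (map_zero _).symm))
  refine bijective_lcomp_of_surjective _ (D.surjective_tensorPowerToIdeal m) fun t ht => ?_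
  obtain ⟨r, hr, hr'⟩ := D.exists_pow_emb_smul_eq m w t
  rw [ht, Submodule.coe_zero, FaithfulSMul.algebraMap_eq_zero_iff] at hr
  exact ⟨_, pow_ne_zero m hw0, by rw [hr', hr, zero_smul]⟩

/-- The dual of `ω ⊗ ⋯ ⊗ ω` is `R : I ^ m`. -/
lemma nonempty_dual_tensorPower_equiv (m : ℕ) :
    Nonempty (Module.Dual R (⨂[R]^m ω) ≃ₗ[R] ↥(1 / D.ideal ^ m)) :=
  ⟨((LinearEquiv.ofBijective _ (bijective_oneDivToDual (D.ideal_pow_ne_bot m))).trans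
    (LinearEquiv.ofBijective _ (D.bijective_lcomp_tensorPowerToIdeal m))).symm⟩

variable [IsNoetherianRing R] [IsIntegrallyClosed R]

lemma nonempty_dual_biDual_tensorPower_equiv (m : ℕ) :
    Nonempty (Module.Dual R (BiDual R (⨂[R]^m ω)) ≃ₗ[R] ↥(1 / D.ideal ^ m)) := by
  obtain ⟨e⟩ := D.nonempty_dual_tensorPower_equiv m
  have := finite_one_div (D.ideal_pow_ne_bot m)
  have := (isWModule_one_div (D.ideal ^ m)).isReflexive
  exact ⟨(dualCongr (dualCongr e)).trans (Module.evalEquiv R _).symm⟩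

lemma nonempty_dual_dual_biDual_tensorPower_equiv (m : ℕ) :
    Nonempty (Module.Dual R (Module.Dual R (BiDual R (⨂[R]^m ω))) ≃ₗ[R]
      divHull (D.ideal ^ m)) := by
  obtain ⟨e⟩ := D.nonempty_dual_biDual_tensorPower_equiv m
  exact ⟨(dualCongr e).trans
    (LinearEquiv.ofBijective _ (bijective_oneDivToDual (D.one_div_ne_bot m))).symm⟩

variable {X : Type u} [AddCommGroup X] [Module R X] [Module.Finite R X]

lemma finite_ideal_pow (m : ℕ) : Module.Finite R ↥(D.ideal ^ m) := by
  rw [Module.Finite.iff_fg]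
  exact (((IsNoetherian.noetherian (LinearMap.range D.emb)).map _).pow m)

lemma nonempty_biDual_reflPow_nat_tensor_equiv (hX : IsWModule R X) (m : ℕ) :
    Nonempty (BiDual R (reflPow R ω (m : ℤ) ⊗[R] X) ≃ₗ[R] (↥(1 / D.ideal ^ m) →ₗ[R] X)) :=
  have := D.finite_ideal_pow m
  nonempty_biDual_tensor_equiv (D.ideal_pow_ne_bot m) (D.one_div_ne_bot m)
    (D.nonempty_dual_biDual_tensorPower_equiv m) hX

lemma nonempty_biDual_reflPow_negSucc_tensor_equiv (hX : IsWModule R X) (m : ℕ) :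
    Nonempty (BiDual R (reflPow R ω (Int.negSucc m) ⊗[R] X) ≃ₗ[R]
      (divHull (D.ideal ^ (m + 1)) →ₗ[R] X)) :=
  have := finite_one_div (D.ideal_pow_ne_bot (m + 1))
  nonempty_biDual_tensor_equiv (D.one_div_ne_bot (m + 1)) (D.divHull_ne_bot (m + 1))
    (D.nonempty_dual_dual_biDual_tensorPower_equiv (m + 1)) hX

variable [NeZero n]

-- The powers are periodic modulo n up to multiplication by powers of q, so the residue class of -a
-- serves.
omit [Nontrivial ω] in
lemma exists_nonempty_piece_equiv (a : ℕ) :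
    ∃ j : ZMod n, Nonempty (D.piece j ≃ₗ[R] ↥(1 / D.ideal ^ a)) := by
  have h : (a + (-(a : ZMod n)).val) % n = 0 := by
    rw [← Nat.mod_add_mod, ← ZMod.val_natCast n a, ← ZMod.val_add, add_neg_cancel, ZMod.val_zero]
  exact ⟨_, D.nonempty_divHull_equiv (Nat.mul_div_cancel' (Nat.dvd_of_mod_eq_zero h)).symm⟩

omit [Nontrivial ω] in
lemma exists_nonempty_divHull_equiv (b : ℕ) :
    ∃ a : ℕ, Nonempty (divHull (D.ideal ^ b) ≃ₗ[R] ↥(1 / D.ideal ^ a)) :=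
  -- Any a ≥ 0 with a + b divisible by n would do; nb - b is nonnegative because n ≥ 1.
  ⟨n * b - b, D.nonempty_divHull_equiv (k := b)
    (Nat.sub_add_cancel (Nat.le_mul_of_pos_left b (NeZero.pos n)))⟩

/-- Both sides are the condition that Hom(R : I^a, X) is CM for all a ≥ 0: positive powers of ω give
it directly, negative powers and the pieces S_j through periodicity. -/
lemma forall_isCM_reflPow_iff (hX : IsWModule R X) :
    (∀ i : ℤ, IsCM R (BiDual R (reflPow R ω i ⊗[R] X))) ↔
      ∀ j, IsCM R (D.piece j →ₗ[R] X) := by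
  constructor
  · intro h j
    obtain ⟨a, ⟨e⟩⟩ := D.exists_nonempty_divHull_equiv j.val
    obtain ⟨e'⟩ := D.nonempty_biDual_reflPow_nat_tensor_equiv hX a
    exact (h a).of_linearEquiv ((LinearEquiv.congrLeft X R e).trans e'.symm)
  · intro h i
    have key : ∀ a : ℕ, IsCM R (↥(1 / D.ideal ^ a) →ₗ[R] X) := fun a => by
      obtain ⟨j, ⟨e⟩⟩ := D.exists_nonempty_piece_equiv a
      exact (h j).of_linearEquiv (LinearEquiv.congrLeft X R e.symm)
    cases i with
    | ofNat m =>
      obtain ⟨e⟩ := D.nonempty_biDual_reflPow_nat_tensor_equiv hX m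
      exact (key m).of_linearEquiv e
    | negSucc m =>
      obtain ⟨e⟩ := D.nonempty_biDual_reflPow_negSucc_tensor_equiv hX m
      obtain ⟨a, ⟨e'⟩⟩ := D.exists_nonempty_divHull_equiv (m + 1)
      exact (key a).of_linearEquiv (e.trans (LinearEquiv.congrLeft X R e'))

omit [Nontrivial ω] [IsIntegrallyClosed R] [Module.Finite R X] in
lemma isCM_cover_hom_iff : IsCM R (D.Cover →ₗ[R] X) ↔ ∀ j, IsCM R (D.piece j →ₗ[R] X) :=
  (isCM_congr ((LinearEquiv.congrLeft X R D.coverEquivPi).trans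
    (LinearMap.lsum R (fun j : ZMod n => D.piece j) R).symm)).trans isCM_pi_iff

omit [Nontrivial ω] [IsIntegrallyClosed R] [Module.Finite R X] in
lemma isCM_piece_zero_hom_iff : IsCM R (D.piece 0 →ₗ[R] X) ↔ IsCM R X := by
  have h : D.piece 0 = 1 := by rw [piece, ZMod.val_zero, pow_zero, divHull_one]
  exact isCM_congr ((LinearEquiv.congrLeft X R
    ((LinearEquiv.ofEq _ _ h).trans (oneEquiv R))).trans (LinearMap.ringLmapEquivSelf R R X))

-- The piece S_0 = R contributes X itself to Hom_R(S, X), so X is CM; conversely a CM module is a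
-- w-module, hence reflexive.
omit [Module.Finite R X] in
lemma isReflexive_and_isCM_hom_iff :
    (Module.Finite R X ∧ Module.IsReflexive R X ∧ IsCM R (D.Cover →ₗ[R] X)) ↔
      (IsCM R X ∧ ∀ i : ℤ, IsCM R (BiDual R (reflPow R ω i ⊗[R] X))) := by
  constructor
  · rintro ⟨_, _, h⟩
    rw [D.isCM_cover_hom_iff] at h
    exact ⟨D.isCM_piece_zero_hom_iff.1 (h 0),
      (D.forall_isCM_reflPow_iff IsWModule.of_isReflexive).2 h⟩
  · rintro ⟨h, h'⟩
    have := h.finite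
    exact ⟨h.finite, h.isWModule.isReflexive,
      D.isCM_cover_hom_iff.2 ((D.forall_isCM_reflPow_iff h.isWModule).1 h')⟩

omit [Nontrivial ω] [IsNoetherianRing R] [IsIntegrallyClosed R] in
lemma nontrivial_cover : Nontrivial D.Cover := by
  refine ⟨D.incl 0 ⟨1, D.one_mem_piece⟩, 0, fun h => ?_⟩
  have h1 := congrArg (D.component 0) h
  rw [component_incl_self, map_zero] at h1
  exact one_ne_zero (congrArg Subtype.val h1)

end CoverDatum

/-- The type is the length of Ext^d, which would be 0 for the zero module; d exists because a
noetherian local ring has finite dimension. -/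
lemma IsCanonicalModule.nontrivial {R : Type u} [CommRing R] [IsNoetherianRing R] [IsLocalRing R]
    {ω : Type u} [AddCommGroup ω] [Module R ω] (h : IsCanonicalModule R ω) : Nontrivial ω := by
  by_contra hω
  rw [not_nontrivial_iff_subsingleton] at hω
  obtain ⟨d, hd⟩ : ∃ d : ℕ, ringKrullDim R = d := by
    obtain ⟨e, he⟩ := WithBot.ne_bot_iff_exists.1 (ringKrullDim_ne_bot (R := R))
    have : e ≠ ⊤ := fun h => ringKrullDim_ne_top (R := R) (by rw [← he, h]; rfl)
    obtain ⟨d, rfl⟩ := ENat.ne_top_iff_exists.1 this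
    exact ⟨d, he.symm⟩
  have h0 : 𝟙 (ModuleCat.of R ω) = 0 := by
    ext x
    exact Subsingleton.elim _ _
  have : Subsingleton (Abelian.Ext.{u} (ModuleCat.of R (IsLocalRing.ResidueField R))
      (ModuleCat.of R ω) d) := by
    refine subsingleton_of_forall_eq 0 fun x => ?_
    rw [← x.comp_mk₀_id, h0, Abelian.Ext.mk₀_zero, Abelian.Ext.comp_zero]
  have h1 := h.type_eq_one d hd
  rw [Module.length_eq_zero] at h1
  exact zero_ne_one h1

end CanonicalCovers

/-! ### Assembly of the equivalences -/

theorem mainTheorem5 {R : Type u} [CommRing R] [IsNoetherianRing R] [IsLocalRing R] [IsDomain R]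
    [IsIntegrallyClosed R] (hR : CanonicalCovers.IsCM R R)
    (ω : Type u) [AddCommGroup ω] [Module R ω] (hω : CanonicalCovers.IsCanonicalModule R ω)
    (n : ℕ) [NeZero n] (hn : CanonicalCovers.IsQGorensteinOfIndex R ω n)
    (D : CanonicalCovers.CoverDatum R ω n) :
    (∀ (N : Type u) [AddCommGroup N] [Module R N] [Module D.Cover N] [IsScalarTower R D.Cover N]
      [Nontrivial N] (𝒩 : ZMod n → AddSubgroup N),
      CanonicalCovers.IsGradedModule D.grading 𝒩 →
      CanonicalCovers.GivesGM D.Cover N →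
        Nonempty (CanonicalCovers.GradedCMCat R (CanonicalCovers.endGrading D.Cover 𝒩) ≌
          CanonicalCovers.CMCat R (CanonicalCovers.EndRing R N)) ∧
        Nonempty (CanonicalCovers.CMCat R (CanonicalCovers.EndRing R N) ≌
          CanonicalCovers.ZCat R N)) ∧
    Nonempty (CanonicalCovers.GradedCMCat R D.grading ≌
      CanonicalCovers.OmegaStableCMCat R ω) := by
  have := hω.nontrivial
  have hS := D.isGVStronglyGraded
  have := D.finite_cover
  refine ⟨fun N _ _ _ _ _ 𝒩 h𝒩 hN => ?_, ?_⟩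
  · have := hN.finite
    have := hN.isReflexive
    have := Module.Finite.trans (R := R) D.Cover N
    have hW : CanonicalCovers.IsWModule R N := D.isWModule_cover.of_isReflexive_algebra
    obtain ⟨e, he⟩ := hS.isSmashProduct_end h𝒩 hW
    exact ⟨he.nonempty_equivalence, CanonicalCovers.nonempty_equivalence_zCat R N hW⟩
  -- Graded CM modules over S are CM modules over End_R(S), hence reflexive X with Hom_R(S, X) CM;
  -- that subcategory of R-modules is equal to the one stable under the powers of ω.
  · obtain ⟨e, he⟩ := hS.isSmashProduct_self D.isWModule_cover
    have := D.nontrivial_cover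
    obtain ⟨F⟩ := he.nonempty_equivalence
    obtain ⟨G⟩ := CanonicalCovers.nonempty_equivalence_zCat R D.Cover D.isWModule_cover
    exact ⟨(F.trans G).trans (ObjectProperty.fullSubcategoryCongr
      (funext fun X => propext D.isReflexive_and_isCM_hom_iff))⟩
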